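/- Let $M$ be a smooth ($C^\infty$, Hausdorff, second countable) manifold without boundary of finite dimension. Put $T^0M=M$, $T^{k+1}M=T(T^kM)$, and let $\pi_k\colon T^{k+1}M\to T^kM$ be the canonical projection. For $k\ge 2$ let $\kappa_k\colon T^kM\to T^kM$ be the canonical involution, determined by $\partial_t\partial_s c=\kappa_k\circ\partial_s\partial_t c$ for smooth maps $c(t,s)$ into $T^{k-2}M$ (in canonical local coordinates, $\kappa_k(x,y,X,Y)=(x,X,y,Y)$). For $k\ge 1$ let $$T^kM\setminus\{0\}=\{\xi\in T^kM : D(\pi_{T^{k-1}M\to M})(\xi)\ne 0\},$$ where $\pi_{T^{k-1}M\to M}\colon T^{k-1}M\to M$ is the composed canonical projection. Let $r\ge 0$. A spray on $T^rM$ is a smooth vector field $S$ on $T^{r+1}M\setminus\{0\}$ with $D\pi_r\circ S=\mathrm{id}$ and $[E_{r+1},S]=S$, where $E_{r+1}(\xi)=\partial_s((1+s)\xi)|_{s=0}$ is the Liouville vector field on $T^{r+1}M$. Its complete lift is the vector field $$S^c=D\kappa_{r+2}\circ\kappa_{r+3}\circ DS\circ\kappa_{r+2}$$ on $T^{r+2}M\setminus\{0\}$.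 **Proposition.** Let $S$ be a spray on $T^rM$, $r\ge 0$, with complete lift $S^c$, and let $\phi\colon\operatorname{dom}(S)\to T^{r+1}M\setminus\{0\}$ and $\phi^c\colon\operatorname{dom}(S^c)\to T^{r+2}M\setminus\{0\}$ be the flows of the vector fields $S$ and $S^c$ on their maximal domains $\operatorname{dom}(S)\subset (T^{r+1}M\setminus\{0\})\times\mathbb{R}$ and $\operatorname{dom}(S^c)\subset (T^{r+2}M\setminus\{0\})\times\mathbb{R}$. Then $$(D\pi_r\times\mathrm{id}_{\mathbb{R}})\,\operatorname{dom}(S^c)=\operatorname{dom}(S),$$ and for all $(\xi,t)\in\operatorname{dom}(S^c)$ the map $\phi_t\colon\eta\mapsto\phi_t(\eta)$ is differentiable at the base point $\pi_{r+1}(\kappa_{r+2}(\xi))$ and $$\phi^c_t(\xi)=\kappa_{r+2}\circ D\phi_t\circ\kappa_{r+2}(\xi).$$ -/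

import Mathlib

universe u

open scoped Manifold ContDiff

noncomputable section


section CurveCoordinates
open Bundle
variable {E : Type*} [NormedAddCommGroup E] [NormedSpace ℝ E] {H : Type*} [TopologicalSpace H]
  {I : ModelWithCorners ℝ E H} {M : Type*} [TopologicalSpace M] [ChartedSpace H M]

/-- The velocity of a curve, read in the preferred chart at its base point. -/
theorem mfderiv_curve_eq_deriv {γ : ℝ → M} {t : ℝ} (hγ : MDifferentiableAt 𝓘(ℝ, ℝ) I γ t) :
    (mfderiv 𝓘(ℝ, ℝ) I γ t (1 : ℝ) : E) = deriv (fun t' => extChartAt I (γ t) (γ t')) t := by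
  rw [hγ.mfderiv]
  simp [writtenInExtChartAt, Function.comp_def, fderivWithin_univ]
  rfl

/-- The velocity of a curve, read in the chart at `x₀`. -/
theorem trivializationAt_curve [IsManifold I 1 M] {γ : ℝ → M} {t : ℝ} {x₀ : M}
    (hγ : MDifferentiableAt 𝓘(ℝ, ℝ) I γ t) (hx : γ t ∈ (chartAt H x₀).source) :
    (trivializationAt E (TangentSpace I) x₀
      (⟨γ t, mfderiv 𝓘(ℝ, ℝ) I γ t (1 : ℝ)⟩ : TangentBundle I M)).2 =
      deriv (fun t' => extChartAt I x₀ (γ t')) t := by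
  have h1 : MDifferentiableAt I 𝓘(ℝ, E) (extChartAt I x₀) (γ t) :=
    mdifferentiableAt_extChartAt hx
  have h2 := TangentBundle.continuousLinearMapAt_trivializationAt (I := I) hx
  have h3 : mfderiv 𝓘(ℝ, ℝ) 𝓘(ℝ, E) (extChartAt I x₀ ∘ γ) t = _ := mfderiv_comp t h1 hγ
  rw [← h2, mfderiv_eq_fderiv] at h3
  have h4 := congrArg (fun L : ℝ →L[ℝ] E => L 1) h3
  change _ = deriv (extChartAt I x₀ ∘ γ) t
  rw [← fderiv_apply_one_eq_deriv]
  refine Eq.trans ?_ h4.symm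
  exact ((trivializationAt E (TangentSpace I) x₀).continuousLinearMapAt_apply_of_mem (R := ℝ)
    (by simpa using hx) _).symm

/-- A second iterated velocity `∂_t ∂_s c`, read in the preferred chart. -/
theorem mfderiv_curve_mfderiv_curve [IsManifold I ∞ M] {V : Type*} [NormedAddCommGroup V]
    [NormedSpace ℝ V] {c : V → M} {α : ℝ → V} {β : ℝ → ℝ → V} {a b : V} {t s : ℝ}
    (hc : ContMDiffAt 𝓘(ℝ, V) I 2 c (α t)) (hα : HasDerivAt α a t)
    (hβ : ∀ t', HasDerivAt (β t') b s) (hαβ : ∀ t', β t' s = α t') :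
    (mfderiv 𝓘(ℝ, ℝ) I (fun s' => c (β t s')) s (1 : ℝ) : E) =
        fderiv ℝ (fun v => extChartAt I (c (α t)) (c v)) (α t) b ∧
    (mfderiv 𝓘(ℝ, ℝ) I.tangent (fun t' => (⟨c (β t' s),
        mfderiv 𝓘(ℝ, ℝ) I (fun s' => c (β t' s')) s (1 : ℝ)⟩ : TangentBundle I M)) t (1 : ℝ) :
        E × E) =
      (fderiv ℝ (fun v => extChartAt I (c (α t)) (c v)) (α t) a,
        fderiv ℝ (fderiv ℝ (fun v => extChartAt I (c (α t)) (c v))) (α t) a b) := by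
  set x₀ := c (α t) with hx₀
  set u : V → E := fun v => extChartAt I x₀ (c v) with hu
  have hu2 : ContDiffAt ℝ 2 u (α t) := by
    rw [← contMDiffAt_iff_contDiffAt]
    exact (contMDiffAt_extChartAt (I := I) (n := 2) (x := x₀)).comp (α t) hc
  have hev : ∀ᶠ v in nhds (α t), MDifferentiableAt 𝓘(ℝ, V) I c v ∧
      c v ∈ (chartAt H x₀).source ∧ DifferentiableAt ℝ u v := by
    have h1 : ∀ᶠ v in nhds (α t), ContMDiffAt 𝓘(ℝ, V) I 2 c v :=
      (contMDiffAt_iff_contMDiffAt_nhds (by simp)).1 hc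
    have h2 : ∀ᶠ v in nhds (α t), c v ∈ (chartAt H x₀).source :=
      hc.continuousAt.preimage_mem_nhds ((chartAt H x₀).open_source.mem_nhds (mem_chart_source H x₀))
    have h3 : ∀ᶠ v in nhds (α t), ContDiffAt ℝ 2 u v := hu2.eventually (by simp)
    filter_upwards [h1, h2, h3] with v h1 h2 h3
    exact ⟨h1.mdifferentiableAt (by simp), h2, h3.differentiableAt (by simp)⟩
  have hev' : ∀ᶠ t' in nhds t, MDifferentiableAt 𝓘(ℝ, V) I c (α t') ∧
      c (α t') ∈ (chartAt H x₀).source ∧ DifferentiableAt ℝ u (α t') :=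
    hα.continuousAt.eventually hev
  have hfib : ∀ t', (MDifferentiableAt 𝓘(ℝ, V) I c (α t') ∧
      c (α t') ∈ (chartAt H x₀).source ∧ DifferentiableAt ℝ u (α t')) →
      (trivializationAt E (TangentSpace I) x₀ (⟨c (β t' s),
        mfderiv 𝓘(ℝ, ℝ) I (fun s' => c (β t' s')) s (1 : ℝ)⟩ : TangentBundle I M)).2 =
      fderiv ℝ u (α t') b := by
    rintro t' ⟨h1, h2, h3⟩
    rw [← hαβ] at h1 h2 h3 ⊢
    have hm : MDifferentiableAt 𝓘(ℝ, ℝ) I (fun s' => c (β t' s')) s :=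
      h1.comp s (hβ t').differentiableAt.mdifferentiableAt
    refine (trivializationAt_curve (I := I) (γ := fun s' => c (β t' s')) hm h2).trans ?_
    exact (h3.hasFDerivAt.comp_hasDerivAt s (hβ t')).deriv
  refine ⟨?_, ?_⟩
  · have h := hev'.self_of_nhds
    have h1 := h.1
    have h3 := h.2.2
    rw [← hαβ] at h1 h3
    have hm : MDifferentiableAt 𝓘(ℝ, ℝ) I (fun s' => c (β t s')) s :=
      h1.comp s (hβ t).differentiableAt.mdifferentiableAt
    refine (mfderiv_curve_eq_deriv hm).trans ?_
    simp only [hαβ]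
    have h5 := (h3.hasFDerivAt.comp_hasDerivAt s (hβ t)).deriv
    rw [hαβ] at h5
    exact h5
  · set Γ : ℝ → TangentBundle I M := fun t' => ⟨c (β t' s),
        mfderiv 𝓘(ℝ, ℝ) I (fun s' => c (β t' s')) s (1 : ℝ)⟩ with hΓ
    have hproj : (Γ t).proj = x₀ := by simp [hΓ, hαβ, hx₀]
    have hfd : HasDerivAt (fun t' => fderiv ℝ u (α t') b)
        (fderiv ℝ (fderiv ℝ u) (α t) a b) t := by
      have h1 : DifferentiableAt ℝ (fderiv ℝ u) (α t) :=
        (hu2.fderiv_right (m := 1) (by norm_num)).differentiableAt (by simp)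
      exact (h1.hasFDerivAt.comp_hasDerivAt t hα).clm_apply (hasDerivAt_const t b) |>.congr_deriv
        (by simp)
    have hud : HasDerivAt (fun t' => u (α t')) (fderiv ℝ u (α t) a) t :=
      hev'.self_of_nhds.2.2.hasFDerivAt.comp_hasDerivAt t hα
    have hee : (fun t' => (trivializationAt E (TangentSpace I) x₀ (Γ t')).2) =ᶠ[nhds t]
        fun t' => fderiv ℝ u (α t') b := by
      filter_upwards [hev'] with t' h using hfib t' h
    have hΓm : MDifferentiableAt 𝓘(ℝ, ℝ) I.tangent Γ t := by
      refine (mdifferentiableAt_totalSpace I Γ).2 ⟨?_, ?_⟩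
      · simp only [hΓ, hαβ]
        exact hev'.self_of_nhds.1.comp t hα.differentiableAt.mdifferentiableAt
      · rw [hproj]
        exact (hfd.congr_of_eventuallyEq hee).differentiableAt.mdifferentiableAt
    refine (mfderiv_curve_eq_deriv hΓm).trans ?_
    have hext : (fun t' => extChartAt I.tangent (Γ t) (Γ t')) =ᶠ[nhds t]
        fun t' => (u (α t'), fderiv ℝ u (α t') b) := by
      filter_upwards [hee] with t' h
      refine Prod.ext ?_ ?_
      · change extChartAt I (Γ t).proj (c (β t' s)) = _
        rw [hproj, hαβ]
      · refine Eq.trans ?_ h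
        rw [← hproj]
        rfl
    rw [hext.deriv_eq]
    exact (hud.prodMk hfd).deriv

end CurveCoordinates

/-- A bundled smooth (`C^∞`) real manifold, so that the tangent bundle of a manifold is
again an object of the same kind and can be iterated. -/
structure SmoothMfd : Type (u + 1) where
  /-- model vector space -/
  E : Type
  [instNACG : NormedAddCommGroup E]
  [instNS : NormedSpace ℝ E]
  /-- model space of the charts -/
  H : Type
  [instTopH : TopologicalSpace H]
  /-- model with corners -/
  I : ModelWithCorners ℝ E H
  /-- the set of points -/
  carrier : Type u
  [instTop : TopologicalSpace carrier]
  [instCharted : ChartedSpace H carrier]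
  [instMfd : IsManifold I ∞ carrier]

namespace SmoothMfd

instance : CoeSort SmoothMfd.{u} (Type u) := ⟨SmoothMfd.carrier⟩

attribute [instance] instNACG instNS instTopH instTop instCharted instMfd

/-- An `n`-dimensional smooth manifold without boundary, as a bundled manifold. -/
def ofManifold (n : ℕ) (M : Type u) [TopologicalSpace M]
    [ChartedSpace (EuclideanSpace ℝ (Fin n)) M] [IsManifold (𝓡 n) ∞ M] : SmoothMfd.{u} where
  E := EuclideanSpace ℝ (Fin n)
  H := EuclideanSpace ℝ (Fin n)
  I := 𝓡 n
  carrier := M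

/-- The tangent bundle `TN`, as a bundled manifold. -/
def T (N : SmoothMfd.{u}) : SmoothMfd.{u} where
  E := N.E × N.E
  H := ModelProd N.H N.E
  I := N.I.tangent
  carrier := TangentBundle N.I N

/-- The iterated tangent bundle `T^r M`: `T^0 M = M` and `T^{r+1} M = T(T^r M)`. -/
def iter (M : SmoothMfd.{u}) : ℕ → SmoothMfd.{u}
  | 0 => M
  | r + 1 => (M.iter r).T

/-- The point of `TN` with base point `x` and tangent vector `v ∈ T_x N`. -/
def vec {N : SmoothMfd.{u}} (x : N) (v : TangentSpace N.I x) : N.T :=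
  (⟨x, v⟩ : TangentBundle N.I N)

/-- The canonical projection `π : TN → N`. -/
def π {N : SmoothMfd.{u}} (ξ : N.T) : N :=
  Bundle.TotalSpace.proj (show TangentBundle N.I N from ξ)

/-- The fibre component of `ξ ∈ TN`, a tangent vector at `π ξ`. -/
def fib {N : SmoothMfd.{u}} (ξ : N.T) : TangentSpace N.I (π ξ) :=
  Bundle.TotalSpace.snd (show TangentBundle N.I N from ξ)

/-- The tangent map `Df : TN → TP` of `f : N → P`. -/
def D {N P : SmoothMfd.{u}} (f : N → P) : N.T → P.T :=
  tangentMap N.I P.I f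

/-- The tangent `γ'(t) ∈ TN` of a curve `γ` in `N`. -/
def velocity {N : SmoothMfd.{u}} (γ : ℝ → N) (t : ℝ) : N.T :=
  vec (γ t) (mfderiv 𝓘(ℝ, ℝ) N.I γ t (1 : ℝ))

/-- The canonical involution `κ : TTN → TTN`, in canonical local coordinates
`κ(x, y, X, Y) = (x, X, y, Y)`.  In Mathlib the tangent space at a point is the model vector
space, through the preferred chart at that point; the preferred chart of `TN` at `(x, y)` is the
one induced by the preferred chart of `N` at `x`, whatever `y` is.  The components of
`((x, y), (X, Y))` are therefore its canonical coordinates for the preferred chart at `x`.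
The theorem `velocity_velocity_eq_kappa` below is the defining property of `κ`. -/
def kappa {N : SmoothMfd.{u}} (p : N.T.T) : N.T.T :=
  vec (N := N.T) (vec (π (π p)) ((show N.E × N.E from fib p).1))
    (show N.E × N.E from (fib (π p), (show N.E × N.E from fib p).2))

/-- The defining property of the canonical involution: `∂_t ∂_s c = κ (∂_s ∂_t c)`. -/
theorem velocity_velocity_eq_kappa {N : SmoothMfd.{u}} {c : ℝ × ℝ → N} {t s : ℝ}
    (hc : ContMDiffAt 𝓘(ℝ, ℝ × ℝ) N.I ∞ c (t, s)) :
    velocity (N := N.T) (fun t' => velocity (fun s' => c (t', s')) s) t =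
      kappa (velocity (N := N.T) (fun s' => velocity (fun t' => c (t', s')) t) s) := by
  have hc2 : ContMDiffAt 𝓘(ℝ, ℝ × ℝ) N.I 2 c (t, s) := hc.of_le (by exact ENat.LEInfty.out)
  have hs : ∀ t' s' : ℝ, HasDerivAt (fun s' => (t', s')) ((0 : ℝ), (1 : ℝ)) s' := fun t' s' =>
    (hasDerivAt_const s' t').prodMk (hasDerivAt_id s')
  have ht : ∀ s' t' : ℝ, HasDerivAt (fun t' => (t', s')) ((1 : ℝ), (0 : ℝ)) t' := fun s' t' =>
    (hasDerivAt_id t').prodMk (hasDerivAt_const t' s')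
  have h1 := mfderiv_curve_mfderiv_curve (I := N.I) (c := c) (α := fun t' => (t', s))
    (β := fun t' s' => (t', s')) (t := t) (s := s) hc2 (ht s t) (fun t' => hs t' s)
    (fun _ => rfl)
  have h2 := mfderiv_curve_mfderiv_curve (I := N.I) (c := c) (α := fun s' => (t, s'))
    (β := fun s' t' => (t', s')) (t := s) (s := t) hc2 (hs t s) (fun s' => ht s' t)
    (fun _ => rfl)
  have hu2 : ContDiffAt ℝ 2 (fun v => extChartAt N.I (c (t, s)) (c v)) (t, s) := by
    rw [← contMDiffAt_iff_contDiffAt]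
    exact (contMDiffAt_extChartAt (I := N.I) (n := 2) (x := c (t, s))).comp (t, s) hc2
  have hsymm := (hu2.isSymmSndFDerivAt (by simp)).eq (1, 0) (0, 1)
  have key : ∀ (x : N) (vs vt us ut w w' : N.E), vs = us → vt = ut → w = w' →
      vec (N := N.T) (vec x vs) (show N.E × N.E from (ut, w)) =
        kappa (vec (N := N.T) (vec x vt) (show N.E × N.E from (us, w'))) := by
    rintro x vs vt us ut w w' rfl rfl rfl
    rfl
  refine (congrArg (vec (N := N.T) _) h1.2).trans ?_
  refine Eq.trans ?_ (congrArg (fun v => kappa (vec (N := N.T) _ v)) h2.2).symm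
  exact key _ _ _ _ _ _ _ h1.1 h2.1 hsymm

/-- The projection `π_{T^r M → M} : T^r M → M`. -/
def projBase (M : SmoothMfd.{u}) : (r : ℕ) → M.iter r → M
  | 0 => fun x => x
  | r + 1 => fun ξ => M.projBase r (π (N := M.iter r) ξ)

/-- The slashed iterated tangent bundle: all of `M` for `r = 0`, and
`{ξ ∈ T^{r+1} M : (D π_{T^r M → M})(ξ) ≠ 0}` at level `r + 1`; at level `1` this is
`{ξ ∈ TM : ξ ≠ 0}`. -/
def slashed (M : SmoothMfd.{u}) : (r : ℕ) → Set (M.iter r)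
  | 0 => Set.univ
  | r + 1 => {ξ : (M.iter r).T | fib (D (M.projBase r) ξ) ≠ 0}

/-- `X` is a smooth vector field on the open set `U ⊆ N`; values of `X` outside `U` are
irrelevant. -/
def IsVectorFieldOn {N : SmoothMfd.{u}} (X : N → N.T) (U : Set N) : Prop :=
  ContMDiffOn N.I N.T.I ∞ X U ∧ ∀ x ∈ U, π (X x) = x

/-- A vector field, given as a map `X : N → TN` with `π ∘ X = id`, as a dependent function
`x ↦ X x ∈ T_x N`. -/
def toSection {N : SmoothMfd.{u}} (X : N → N.T) (x : N) : TangentSpace N.I x :=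
  show N.E from fib (X x)

/-- The Lie bracket `[X, Y]` of two vector fields. -/
def lieBracket {N : SmoothMfd.{u}} (X Y : N → N.T) (x : N) : N.T :=
  vec x (VectorField.mlieBracket N.I (toSection X) (toSection Y) x)

/-- Scalar multiplication in the fibres of `π : TN → N`. -/
def fibSMul {N : SmoothMfd.{u}} (c : ℝ) (ξ : N.T) : N.T :=
  vec (π ξ) (c • fib ξ)

/-- The Liouville vector field `E(ξ) = ∂_s ((1 + s) ξ)|_{s = 0}` on `TN`. -/
def liouville {N : SmoothMfd.{u}} (ξ : N.T) : N.T.T :=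
  velocity (N := N.T) (fun s : ℝ => fibSMul (1 + s) ξ) 0

/-- `S` is a spray on `T^r M`: a smooth vector field on the slashed tangent bundle
`T^{r+1} M ∖ {0}` with `(D π_r) ∘ S = id` and `[E_{r+1}, S] = S` there. -/
structure IsSpray (M : SmoothMfd.{u}) (r : ℕ) (S : (M.iter r).T → (M.iter r).T.T) : Prop where
  isVectorFieldOn : IsVectorFieldOn S (M.slashed (r + 1))
  D_proj : ∀ ξ ∈ M.slashed (r + 1), D (π (N := M.iter r)) (S ξ) = ξ
  homogeneous : ∀ ξ ∈ M.slashed (r + 1), lieBracket liouville S ξ = S ξ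

/-- The complete lift `S^c = Dκ_{r+2} ∘ κ_{r+3} ∘ DS ∘ κ_{r+2}` of a spray `S` on `N = T^r M`.
-/
def completeLift {N : SmoothMfd.{u}} (S : N.T → N.T.T) : N.T.T → N.T.T.T :=
  fun ξ => D kappa (kappa (N := N.T) (D S (kappa ξ)))

/-- `γ`, restricted to the open interval `J ∋ 0`, is an integral curve `J → U` of the vector
field `X` on `U` with `γ(0) = x`. -/
structure IsIntegralCurveFrom {N : SmoothMfd.{u}} (X : N → N.T) (U : Set N) (x : N)
    (J : Set ℝ) (γ : ℝ → N) : Prop where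
  isOpen : IsOpen J
  ordConnected : J.OrdConnected
  zero_mem : 0 ∈ J
  initial : γ 0 = x
  mem : ∀ t ∈ J, γ t ∈ U
  mdifferentiableAt : ∀ t ∈ J, MDifferentiableAt 𝓘(ℝ, ℝ) N.I γ t
  velocity_eq : ∀ t ∈ J, velocity γ t = X (γ t)

/-- The maximal domain of the flow of the vector field `X` on `U`: all `(x, t)` such that some
integral curve of `X` in `U` starting at `x` is defined at time `t`. -/
def flowDomain {N : SmoothMfd.{u}} (X : N → N.T) (U : Set N) : Set (N × ℝ) :=
  {p | ∃ (γ : ℝ → N) (J : Set ℝ), IsIntegralCurveFrom X U p.1 J γ ∧ p.2 ∈ J}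

open Classical in
/-- The flow of the vector field `X` on `U`: for `(x, t)` in the maximal domain, the value at
time `t` of an integral curve of `X` in `U` starting at `x` and defined at time `t` (any two of
them agree at `t` if `X` is smooth on `U` and `N` is Hausdorff). -/
def flow {N : SmoothMfd.{u}} (X : N → N.T) (U : Set N) (t : ℝ) (x : N) : N :=
  if h : (x, t) ∈ flowDomain X U then h.choose t else x

end SmoothMfd

end

noncomputable section

/-! ### Differentiability of a local flow in the initial value -/

section LocalFlow

open Metric Set Filter Topology
open scoped NNReal

variable {E : Type*} [NormedAddCommGroup E] [NormedSpace ℝ E]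

/-! The statement is a case of a general fact about a smooth vector field $X$ with flow $\phi$ on an
open set $U$ of a manifold $N$: its tangent lift $\kappa\circ DX$ on $\pi^{-1}(U)$ has flow
$D\phi_t$, defined at $(\xi,t)$ exactly when $\phi$ is defined at $(\pi\xi,t)$. Since $S^c =
D\kappa\circ(\kappa\circ DS)\circ\kappa$ and $\kappa$ is an involution, $S^c$ is the push-forward of
the tangent lift of $S$ by $\kappa$. So its flow is $\kappa\circ D\phi_t\circ\kappa$, and $(\xi,t)$
lies in its domain iff $(\pi\kappa\xi,t)$ lies in that of $S$ (`mem_flowDomain_completeLift_iff`,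
`flow_completeLift`). The identity $D\pi=\pi\circ\kappa$ (`D_π_eq`) turns this into the claim about
domains.

The fact about tangent lifts is first proved locally. If $f$ represents $X$ in a chart, the lift is
represented by $(z,v)\mapsto(f(z),Df(z)v)$ (`tangentLift_tparam`), so its integral curves solve the
linearized equation. Solving $z'=f(z)$, $A'=Df(z)A$ together and comparing by Grönwall's inequality
shows that $A$ is the derivative of the flow in the initial value
(`ContDiffAt.exists_local_flow_hasFDerivAt`). This gives short times, uniformly near a point
(`exists_eventually_regularFlowAt`). The group law and the chain rule compose such steps, and
connectedness of the time interval carries them along a whole integral curve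
(`regularFlowAt_of_mem`). Conversely, $\pi$ projects integral curves of the lift to integral curves
of $X$. -/

/-- Pulls the quadratic factor $\|z'-z\|^2$ out of the Grönwall bound, leaving a constant
independent of $z'$. -/
theorem gronwallBound_zero_eq_mul (K δ x : ℝ) :
    gronwallBound 0 K δ x = δ * gronwallBound 0 K 1 x := by
  by_cases hK : K = 0
  · simp [hK, gronwallBound_K0]
  · simp only [gronwallBound_of_K_ne_0 hK]
    ring

/-- A two-sided Grönwall inequality for a function vanishing at `0`. -/
theorem norm_le_gronwallBound_abs {w w' : ℝ → E} {K δ ε : ℝ}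
    (hw : ∀ t ∈ Ioo (-ε) ε, HasDerivAt w (w' t) t) (h0 : w 0 = 0)
    (hb : ∀ t ∈ Ioo (-ε) ε, ‖w' t‖ ≤ K * ‖w t‖ + δ) {t : ℝ} (ht : t ∈ Ioo (-ε) ε) :
    ‖w t‖ ≤ gronwallBound 0 K δ |t| := by
  have key : ∀ (v v' : ℝ → E), (∀ t ∈ Ioo (-ε) ε, HasDerivAt v (v' t) t) → v 0 = 0 →
      (∀ t ∈ Ioo (-ε) ε, ‖v' t‖ ≤ K * ‖v t‖ + δ) → ∀ t ∈ Ico 0 ε,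
      ‖v t‖ ≤ gronwallBound 0 K δ t := by
    intro v v' hv h0 hb t ht
    have hsub : ∀ s ∈ Icc 0 t, s ∈ Ioo (-ε) ε := fun s hs =>
      ⟨by linarith [hs.1, ht.1, ht.2], by linarith [hs.2, ht.2]⟩
    have h := norm_le_gronwallBound_of_norm_deriv_right_le (f := v) (f' := v') (δ := 0) (K := K)
      (ε := δ) (a := 0) (b := t) (fun s hs => (hv s (hsub s hs)).continuousAt.continuousWithinAt)
      (fun s hs => (hv s (hsub s ⟨hs.1, hs.2.le⟩)).hasDerivWithinAt) (by simp [h0])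
      (fun s hs => hb s (hsub s ⟨hs.1, hs.2.le⟩)) t ⟨ht.1, le_rfl⟩
    simpa using h
  rcases le_total 0 t with h | h
  · rw [abs_of_nonneg h]
    exact key w w' hw h0 hb t ⟨h, ht.2⟩
  · rw [abs_of_nonpos h]
    have hneg : ∀ s ∈ Ioo (-ε) ε, -s ∈ Ioo (-ε) ε := fun s hs =>
      ⟨by linarith [hs.2], by linarith [hs.1]⟩
    have h1 := key (fun s => w (-s)) (fun s => -w' (-s))
      (fun s hs => by
        have h2 := (hw (-s) (hneg s hs)).scomp s (hasDerivAt_neg s)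
        simpa [Function.comp_def] using h2)
      (by simpa using h0) (fun s hs => by simpa using hb (-s) (hneg s hs)) (-t)
      ⟨by linarith, by linarith [ht.1]⟩
    simpa using h1

/-- The second order remainder of a map whose derivative is Lipschitz on a convex set. -/
theorem Convex.norm_sub_sub_fderiv_le {f : E → E} {s : Set E} {C : ℝ≥0} (hs : Convex ℝ s)
    (hf : ∀ z ∈ s, DifferentiableAt ℝ f z) (hC : LipschitzOnWith C (fderiv ℝ f) s) {a b : E}
    (ha : a ∈ s) (hb : b ∈ s) : ‖f b - f a - fderiv ℝ f a (b - a)‖ ≤ C * ‖b - a‖ ^ 2 := by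
  have hseg : segment ℝ a b ⊆ s := hs.segment_subset ha hb
  -- Mean value inequality for $f - Df(a)$, whose derivative on the segment has norm at most
  -- $C\|b-a\|$.
  have h := (convex_segment a b).norm_image_sub_le_of_norm_hasFDerivWithin_le
    (f := fun z => f z - fderiv ℝ f a z) (f' := fun z => fderiv ℝ f z - fderiv ℝ f a)
    (C := C * ‖b - a‖) (𝕜 := ℝ)
    (fun z hz => ((hf z (hseg hz)).hasFDerivAt.sub
      (fderiv ℝ f a).hasFDerivAt).hasFDerivWithinAt)
    (fun z hz => by
      refine (hC.norm_sub_le (hseg hz) ha).trans ?_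
      gcongr
      exact norm_sub_le_of_mem_segment hz)
    (left_mem_segment ℝ a b) (right_mem_segment ℝ a b)
  have he : f b - fderiv ℝ f a b - (f a - fderiv ℝ f a a) = f b - f a - fderiv ℝ f a (b - a) := by
    rw [map_sub]; abel
  simp only [he] at h
  nlinarith [h]

/-- The local flow of a `C^2` vector field on a Banach space is differentiable in the initial
value, and its derivative solves the linearized equation. -/
theorem ContDiffAt.exists_local_flow_hasFDerivAt [CompleteSpace E] {f : E → E} {z₀ : E} {V : Set E}
    (hf : ContDiffAt ℝ 2 f z₀) (hV : V ∈ 𝓝 z₀) :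
    ∃ ρ > 0, ∃ ε > 0, ∃ (φ : E → ℝ → E) (A : E → ℝ → E →L[ℝ] E), ∀ z ∈ ball z₀ ρ,
      φ z 0 = z ∧ A z 0 = ContinuousLinearMap.id ℝ E ∧ ∀ t ∈ Ioo (-ε) ε,
        φ z t ∈ V ∧ HasDerivAt (φ z) (f (φ z t)) t ∧
        HasDerivAt (A z) (fderiv ℝ f (φ z t) ∘L A z t) t ∧
        HasFDerivAt (fun z' => φ z' t) (A z t) z := by
  have hf' : ContDiffAt ℝ 1 (fderiv ℝ f) z₀ := hf.fderiv_right (by norm_num)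
  -- The equation coupled with its linearization. As $f$ is $C^2$, this field is $C^1$, which
  -- Picard–Lindelöf requires; only initial values $(z,\mathrm{id})$ matter.
  set F : E × (E →L[ℝ] E) → E × (E →L[ℝ] E) := fun p => (f p.1, fderiv ℝ f p.1 ∘L p.2) with hF
  have hF1 : ContDiffAt ℝ 1 F (z₀, ContinuousLinearMap.id ℝ E) := by
    refine ContDiffAt.prodMk ((hf.of_le (by norm_num)).comp _ contDiffAt_fst) ?_
    exact ContDiffAt.clm_comp (ContDiffAt.comp (z₀, ContinuousLinearMap.id ℝ E) hf' contDiffAt_fst)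
      contDiffAt_snd
  obtain ⟨ε, hε, a, r, L, K, hr, hpl⟩ := IsPicardLindelof.of_contDiffAt_one hF1
  obtain ⟨α, hα, L', hL'⟩ :=
    (hpl 0).exists_forall_mem_closedBall_eq_hasDerivWithinAt_lipschitzOnWith
  have hcont : ContinuousOn (Function.uncurry α)
      (closedBall (z₀, ContinuousLinearMap.id ℝ E) r ×ˢ Icc (0 - ε) (0 + ε)) :=
    continuousOn_prod_of_continuousOn_lipschitzOnWith _ L'
      (fun x hx => HasDerivWithinAt.continuousOn (hα x hx).2) hL'
  obtain ⟨C, s, hs, hC⟩ := hf'.exists_lipschitzOnWith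
  have hK0 : ∀ᶠ z in 𝓝 z₀, ‖fderiv ℝ f z‖ < ‖fderiv ℝ f z₀‖ + 1 :=
    hf'.continuousAt.norm.eventually_lt continuousAt_const (by simp)
  have hd0 : ∀ᶠ z in 𝓝 z₀, DifferentiableAt ℝ f z :=
    (hf.eventually (by simp)).mono fun z hz => hz.differentiableAt (by simp)
  -- On this ball $Df$ is Lipschitz and bounded and $f$ is differentiable, and the ball lies in $V$;
  -- joint continuity keeps the short-time solutions in it.
  obtain ⟨σ, hσ, hball⟩ := Metric.mem_nhds_iff.1
    (Filter.inter_mem (Filter.inter_mem hs hV) (Filter.inter_mem hK0 hd0))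
  have hca : ContinuousAt (Function.uncurry α) ((z₀, ContinuousLinearMap.id ℝ E), 0) :=
    hcont.continuousAt (prod_mem_nhds (closedBall_mem_nhds _ hr)
      (Icc_mem_nhds (by linarith) (by linarith)))
  have hval : Function.uncurry α ((z₀, ContinuousLinearMap.id ℝ E), 0) =
      (z₀, ContinuousLinearMap.id ℝ E) :=
    (hα _ (mem_closedBall_self r.2)).1
  have hnear : ∀ᶠ p in 𝓝 ((z₀, ContinuousLinearMap.id ℝ E), (0 : ℝ)),
      (Function.uncurry α p).1 ∈ ball z₀ σ := by
    have h2 := hca.fst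
    refine h2 ?_
    change ball z₀ σ ∈ 𝓝 (Function.uncurry α ((z₀, ContinuousLinearMap.id ℝ E), 0)).1
    rw [hval]
    exact ball_mem_nhds _ hσ
  obtain ⟨τ, hτ, hnear⟩ := Metric.eventually_nhds_iff_ball.1 hnear
  refine ⟨min τ r, lt_min hτ hr, min τ ε, lt_min hτ hε,
    fun z t => (α (z, ContinuousLinearMap.id ℝ E) t).1,
    fun z t => (α (z, ContinuousLinearMap.id ℝ E) t).2, ?_⟩
  have hmem : ∀ z ∈ ball z₀ (min τ r),
      (z, ContinuousLinearMap.id ℝ E) ∈ closedBall (z₀, ContinuousLinearMap.id ℝ E) r := by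
    intro z hz
    have h1 := lt_min_iff.1 (mem_ball.1 hz)
    rw [mem_closedBall, Prod.dist_eq, dist_self]
    exact max_le h1.2.le r.2
  have hB : ∀ z ∈ ball z₀ (min τ r), ∀ t ∈ Ioo (-(min τ ε)) (min τ ε),
      (α (z, ContinuousLinearMap.id ℝ E) t).1 ∈ ball z₀ σ := by
    intro z hz t ht
    have h1 := lt_min_iff.1 (mem_ball.1 hz)
    refine hnear ((z, ContinuousLinearMap.id ℝ E), t) ?_
    rw [mem_ball, Prod.dist_eq, Prod.dist_eq, dist_self]
    refine max_lt (max_lt h1.1 hτ) ?_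
    rw [Real.dist_eq, sub_zero]
    exact (abs_lt.2 ht).trans_le (min_le_left _ _)
  have hIcc : ∀ t ∈ Ioo (-(min τ ε)) (min τ ε), t ∈ Ioo (0 - ε) (0 + ε) := by
    intro t ht
    have := min_le_right τ ε
    exact ⟨by linarith [ht.1], by linarith [ht.2]⟩
  have hder : ∀ z ∈ ball z₀ (min τ r), ∀ t ∈ Ioo (-(min τ ε)) (min τ ε),
      HasDerivAt (α (z, ContinuousLinearMap.id ℝ E))
        (F (α (z, ContinuousLinearMap.id ℝ E) t)) t := by
    intro z hz t ht
    have h1 := hIcc t ht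
    exact ((hα _ (hmem z hz)).2 t (Ioo_subset_Icc_self h1)).hasDerivAt (Icc_mem_nhds h1.1 h1.2)
  have hder1 : ∀ z ∈ ball z₀ (min τ r), ∀ t ∈ Ioo (-(min τ ε)) (min τ ε),
      HasDerivAt (fun t => (α (z, ContinuousLinearMap.id ℝ E) t).1)
        (f (α (z, ContinuousLinearMap.id ℝ E) t).1) t := fun z hz t ht =>
    (hasFDerivAt_fst (p := α (z, ContinuousLinearMap.id ℝ E) t)).comp_hasDerivAt t (hder z hz t ht)
  have hder2 : ∀ z ∈ ball z₀ (min τ r), ∀ t ∈ Ioo (-(min τ ε)) (min τ ε),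
      HasDerivAt (fun t => (α (z, ContinuousLinearMap.id ℝ E) t).2)
        (fderiv ℝ f (α (z, ContinuousLinearMap.id ℝ E) t).1 ∘L
          (α (z, ContinuousLinearMap.id ℝ E) t).2) t := fun z hz t ht =>
    (hasFDerivAt_snd (p := α (z, ContinuousLinearMap.id ℝ E) t)).comp_hasDerivAt t (hder z hz t ht)
  have hinit : ∀ z ∈ ball z₀ (min τ r),
      α (z, ContinuousLinearMap.id ℝ E) 0 = (z, ContinuousLinearMap.id ℝ E) := fun z hz =>
    (hα _ (hmem z hz)).1
  intro z hz
  refine ⟨by simp only [hinit z hz], by simp only [hinit z hz], fun t ht =>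
    ⟨(hball (hB z hz t ht)).1.2, hder1 z hz t ht, hder2 z hz t ht, ?_⟩⟩
  set κ := ‖fderiv ℝ f z₀‖ + 1
  -- The error $w = x'-x-A(z'-z)$ vanishes at time $0$ and satisfies $w' = Df(x)w + R$ with
  -- $\|R\|\le C\|x'-x\|^2\le CL'^2\|z'-z\|^2$, where $L'$ is the Lipschitz constant of the solution
  -- in its initial value.
  have hest : ∀ z' ∈ ball z₀ (min τ r),
      ‖(α (z', ContinuousLinearMap.id ℝ E) t).1 - (α (z, ContinuousLinearMap.id ℝ E) t).1 -
        (α (z, ContinuousLinearMap.id ℝ E) t).2 (z' - z)‖ ≤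
      (C * (L' : ℝ) ^ 2 * gronwallBound 0 κ 1 |t|) * ‖z' - z‖ ^ 2 := by
    intro z' hz'
    have hw := fun t ht => ((hder1 z' hz' t ht).sub (hder1 z hz t ht)).sub
      ((hder2 z hz t ht).clm_apply (hasDerivAt_const t (z' - z)))
    have h := norm_le_gronwallBound_abs (K := κ) (δ := C * (L' : ℝ) ^ 2 * ‖z' - z‖ ^ 2) hw
      (by simp [hinit z hz, hinit z' hz']) ?_ ht
    · refine h.trans (le_of_eq ?_)
      rw [gronwallBound_zero_eq_mul]; ring
    · intro s hs
      set x := (α (z, ContinuousLinearMap.id ℝ E) s).1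
      set x' := (α (z', ContinuousLinearMap.id ℝ E) s).1
      set A := (α (z, ContinuousLinearMap.id ℝ E) s).2
      have hx := hball (hB z hz s hs)
      have hx' := hball (hB z' hz' s hs)
      have hrem : ‖f x' - f x - fderiv ℝ f x (x' - x)‖ ≤ C * ‖x' - x‖ ^ 2 :=
        (convex_ball z₀ σ).norm_sub_sub_fderiv_le (fun y hy => (hball hy).2.2)
          (hC.mono fun y hy => (hball hy).1.1) (hB z hz s hs) (hB z' hz' s hs)
      have hlip : ‖x' - x‖ ≤ L' * ‖z' - z‖ := by
        have h1 := (hL' s (Ioo_subset_Icc_self (hIcc s hs))).norm_sub_le (hmem z' hz') (hmem z hz)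
        refine (norm_fst_le _).trans (h1.trans (le_of_eq ?_))
        simp [Prod.norm_def]
      -- The term `A 0` is what the product rule leaves from differentiating the constant $z'-z$.
      have he : f x' - f x - ((fderiv ℝ f x ∘L A) (z' - z) + A 0) =
          fderiv ℝ f x (x' - x - A (z' - z)) + (f x' - f x - fderiv ℝ f x (x' - x)) := by
        simp only [ContinuousLinearMap.comp_apply, map_sub, map_zero]; abel
      change ‖f x' - f x - ((fderiv ℝ f x ∘L A) (z' - z) + A 0)‖ ≤ κ * ‖x' - x - A (z' - z)‖ + _
      rw [he]
      refine (norm_add_le _ _).trans (add_le_add ?_ (hrem.trans ?_))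
      · refine ((fderiv ℝ f x).le_opNorm _).trans ?_
        gcongr
        exact hx.2.1.le
      · rw [mul_assoc, ← mul_pow]
        gcongr
  refine HasFDerivAt.of_isLittleO ?_
  have hO : (fun z' => (α (z', ContinuousLinearMap.id ℝ E) t).1 -
      (α (z, ContinuousLinearMap.id ℝ E) t).1 -
        (α (z, ContinuousLinearMap.id ℝ E) t).2 (z' - z)) =O[𝓝 z] fun z' => ‖z' - z‖ ^ 2 := by
    refine Asymptotics.IsBigO.of_bound (C * (L' : ℝ) ^ 2 * gronwallBound 0 κ 1 |t|) ?_
    filter_upwards [isOpen_ball.mem_nhds hz] with z' hz'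
    simpa using hest z' hz'
  refine hO.trans_isLittleO ?_
  have ht0 : Tendsto (fun z' => z' - z) (𝓝 z) (𝓝 0) := by
    have : Continuous fun z' : E => z' - z := by fun_prop
    simpa using this.tendsto z
  exact (Asymptotics.isLittleO_norm_pow_id (E' := E) one_lt_two).comp_tendsto ht0

end LocalFlow

/-! ### Charts of the tangent bundle and velocities in charts -/

namespace SmoothMfd

open Set Filter Topology

variable {N P Q : SmoothMfd.{u}}

instance instBoundarylessT [N.I.Boundaryless] : N.T.I.Boundaryless :=
  inferInstanceAs (N.I.prod 𝓘(ℝ, N.E)).Boundaryless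

instance instCompleteSpaceT [CompleteSpace N.E] : CompleteSpace N.T.E :=
  inferInstanceAs (CompleteSpace (N.E × N.E))

/-- Vectors over distinct points are separated by open sets of the base; vectors over the same point
lie in one trivialization, whose image is Hausdorff. This is needed for uniqueness of integral
curves in the iterated bundles. -/
theorem t2Space_tangentBundle {E H M : Type*} [NormedAddCommGroup E] [NormedSpace ℝ E]
    [TopologicalSpace H] {I : ModelWithCorners ℝ E H} [TopologicalSpace M] [ChartedSpace H M]
    [IsManifold I 1 M] [T2Space M] : T2Space (TangentBundle I M) := by
  refine ⟨fun p q hpq => ?_⟩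
  by_cases h : p.proj = q.proj
  · set e := trivializationAt E (TangentSpace I) p.proj
    have hp : p ∈ e.source := FiberBundle.mem_trivializationAt_proj_source
    have hq : q ∈ e.source := by rw [e.mem_source, ← h, ← e.mem_source]; exact hp
    have hne : e p ≠ e q := fun h => hpq (e.injOn hp hq h)
    obtain ⟨u, v, hu, hv, hpu, hqv, huv⟩ := t2_separation hne
    exact ⟨e.source ∩ e ⁻¹' u, e.source ∩ e ⁻¹' v, e.toOpenPartialHomeomorph.isOpen_inter_preimage hu,
      e.toOpenPartialHomeomorph.isOpen_inter_preimage hv, ⟨hp, hpu⟩, ⟨hq, hqv⟩,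
      (huv.preimage _).mono inter_subset_right inter_subset_right⟩
  · obtain ⟨u, v, hu, hv, hpu, hqv, huv⟩ := t2_separation h
    have hc : Continuous (Bundle.TotalSpace.proj : TangentBundle I M → M) :=
      FiberBundle.continuous_proj E (TangentSpace I)
    exact ⟨_, _, hu.preimage hc, hv.preimage hc, hpu, hqv, huv.preimage _⟩

instance instT2SpaceT [T2Space N] : T2Space N.T :=
  haveI : IsManifold N.I 1 N := .of_le (n := ∞) (by simp)
  t2Space_tangentBundle (I := N.I) (M := N)

@[simp] theorem π_velocity (γ : ℝ → N) (t : ℝ) : π (velocity γ t) = γ t := rfl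

@[simp] theorem π_D (f : N → P) (ξ : N.T) : π (D f ξ) = f (π ξ) := rfl

/-- The zero vector at `x`. -/
def zeroVec (x : N) : N.T := vec x 0

/-- The inverse of the preferred chart of `N` at `x₀`. -/
def param (x₀ : N) : N.E → N := (extChartAt N.I x₀).symm

/-- The inverse of the preferred chart of `TN` over `x₀`. -/
def tparam (x₀ : N) : N.E × N.E → N.T := param (N := N.T) (zeroVec x₀)

/-- The range of the preferred chart of `N` at `x₀`. -/
def target (x₀ : N) : Set N.E := (extChartAt N.I x₀).target

theorem isOpen_target [N.I.Boundaryless] (x₀ : N) : IsOpen (target x₀) :=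
  isOpen_extChartAt_target x₀

theorem contMDiffOn_param (x₀ : N) : ContMDiffOn 𝓘(ℝ, N.E) N.I ∞ (param x₀) (target x₀) :=
  contMDiffOn_extChartAt_symm x₀

section Unbundled

variable {E H M : Type*} [NormedAddCommGroup E] [NormedSpace ℝ E]
    [TopologicalSpace H] {I : ModelWithCorners ℝ E H} [TopologicalSpace M] [ChartedSpace H M]
    [IsManifold I 1 M]

/-- Charts of the tangent bundle are cylinders over charts of the base, so only the base coordinate
is constrained. The zero vector can therefore serve as centre for the chart over $x_0$. -/
theorem mem_extChartAt_tangent_target {q : TangentBundle I M} {p : E × E} :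
    p ∈ (extChartAt I.tangent q).target ↔ p.1 ∈ (extChartAt I q.proj).target := by
  rw [FiberBundle.extChartAt_target]
  simp only [mem_prod, mem_inter_iff, mem_univ, and_true, and_iff_left_iff_imp]
  intro h
  simpa [extChartAt_source] using (extChartAt I q.proj).map_target h

theorem mem_extChartAt_tangent_source {p q : TangentBundle I M} :
    p ∈ (extChartAt I.tangent q).source ↔ p.proj ∈ (extChartAt I q.proj).source := by
  simp

theorem extChartAt_tangent_symm_proj {q : TangentBundle I M} {p : E × E}
    (hp : p.1 ∈ (extChartAt I q.proj).target) :
    ((extChartAt I.tangent q).symm p).proj = (extChartAt I q.proj).symm p.1 := by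
  have h1 := (extChartAt I.tangent q).right_inv (mem_extChartAt_tangent_target.2 hp)
  have h2 := mem_extChartAt_tangent_source.1
    ((extChartAt I.tangent q).map_target (mem_extChartAt_tangent_target.2 hp))
  have h3 : extChartAt I q.proj ((extChartAt I.tangent q).symm p).proj = p.1 :=
    congrArg Prod.fst h1
  rw [← h3, (extChartAt I q.proj).left_inv h2]

end Unbundled

theorem mem_target_T {x₀ : N} {p : N.E × N.E} :
    (show N.T.E from p) ∈ target (N := N.T) (zeroVec x₀) ↔ p.1 ∈ target x₀ :=
  mem_extChartAt_tangent_target (I := N.I) (q := (zeroVec x₀ : TangentBundle N.I N))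

theorem π_tparam {x₀ : N} {p : N.E × N.E} (hp : p.1 ∈ target x₀) :
    π (tparam x₀ p) = param x₀ p.1 :=
  extChartAt_tangent_symm_proj (I := N.I) (q := (zeroVec x₀ : TangentBundle N.I N)) hp

theorem tparam_chart {x₀ : N} {w : N.T} (hw : π w ∈ (extChartAt N.I x₀).source) :
    tparam x₀ (extChartAt N.I x₀ (π w), (trivializationAt N.E (TangentSpace N.I) x₀ w).2) = w :=
  (extChartAt (M := TangentBundle N.I N) N.I.tangent (zeroVec x₀)).left_inv
    (mem_extChartAt_tangent_source.2 hw)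

theorem mdifferentiableAt_param [N.I.Boundaryless] {x₀ : N} {z : N.E} (hz : z ∈ target x₀) :
    MDifferentiableAt 𝓘(ℝ, N.E) N.I (param x₀) z :=
  ((contMDiffOn_param x₀).contMDiffAt ((isOpen_target x₀).mem_nhds hz)).mdifferentiableAt (by simp)

/-- The dictionary between velocities on the manifold and ordinary derivatives in one fixed chart:
by `trivializationAt_curve` the fibre coordinate is the derivative of the curve read in that chart,
which is $c$ near $t$. Applied to $TN$ it computes second velocities. -/
theorem velocity_param_comp [N.I.Boundaryless] {x₀ : N} {c : ℝ → N.E} {v : N.E} {t : ℝ}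
    (ht : c t ∈ target x₀) (hc : HasDerivAt c v t) :
    velocity (fun s => param x₀ (c s)) t = tparam x₀ (c t, v) := by
  have hw : param x₀ (c t) ∈ (extChartAt N.I x₀).source := (extChartAt N.I x₀).map_target ht
  have hm : MDifferentiableAt 𝓘(ℝ, ℝ) N.I (fun s => param x₀ (c s)) t :=
    (mdifferentiableAt_param ht).comp t hc.differentiableAt.mdifferentiableAt
  have h1 := tparam_chart (w := velocity (fun s => param x₀ (c s)) t) hw
  have h2 : (trivializationAt N.E (TangentSpace N.I) x₀
      (velocity (fun s => param x₀ (c s)) t)).2 = v := by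
    refine (trivializationAt_curve hm (by rwa [extChartAt_source] at hw)).trans ?_
    have h3 : (fun s => extChartAt N.I x₀ (param x₀ (c s))) =ᶠ[𝓝 t] c := by
      filter_upwards [hc.continuousAt.preimage_mem_nhds ((isOpen_target x₀).mem_nhds ht)] with s hs
      exact (extChartAt N.I x₀).right_inv hs
    rw [h3.deriv_eq]
    exact hc.deriv
  rw [h2, π_velocity, show extChartAt N.I x₀ (param x₀ (c t)) = c t from
    (extChartAt N.I x₀).right_inv ht] at h1
  exact h1.symm

end SmoothMfd

/-! ### The canonical involution in an arbitrary chart -/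

namespace SmoothMfd

open Set Filter Topology

variable {N P Q : SmoothMfd.{u}}

theorem velocity_congr {γ δ : ℝ → N} {t : ℝ} (h : γ =ᶠ[𝓝 t] δ) : velocity γ t = velocity δ t := by
  unfold velocity
  rw [h.mfderiv_eq, h.eq_of_nhds]

theorem D_congr {f g : N → P} {ξ : N.T} (h : f =ᶠ[𝓝 (π ξ)] g) : D f ξ = D g ξ := by
  change vec (f (π ξ)) (mfderiv N.I P.I f (π ξ) (fib ξ)) =
    vec (g (π ξ)) (mfderiv N.I P.I g (π ξ) (fib ξ))
  rw [h.mfderiv_eq, h.eq_of_nhds]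

theorem D_comp {f : N → P} {g : P → Q} {ξ : N.T} (hg : MDifferentiableAt P.I Q.I g (f (π ξ)))
    (hf : MDifferentiableAt N.I P.I f (π ξ)) : D (fun x => g (f x)) ξ = D g (D f ξ) :=
  tangentMap_comp_at (I := N.I) (I' := P.I) (I'' := Q.I) (p := ξ) hg hf

theorem D_id (ξ : N.T) : D (fun x : N => x) ξ = ξ :=
  congrFun (tangentMap_id (I := N.I) (M := N)) ξ

theorem D_velocity {f : N → P} {γ : ℝ → N} {t : ℝ} (hf : MDifferentiableAt N.I P.I f (γ t))
    (hγ : MDifferentiableAt 𝓘(ℝ, ℝ) N.I γ t) :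
    D f (velocity γ t) = velocity (fun s => f (γ s)) t := by
  have h := mfderiv_comp (I := 𝓘(ℝ, ℝ)) (I' := N.I) (I'' := P.I) t hf hγ
  change vec (f (γ t)) (mfderiv N.I P.I f (γ t) (mfderiv 𝓘(ℝ, ℝ) N.I γ t (1 : ℝ))) =
    vec (f (γ t)) (mfderiv 𝓘(ℝ, ℝ) P.I (f ∘ γ) t (1 : ℝ))
  rw [h]
  rfl

@[simp] theorem kappa_kappa (ξ : N.T.T) : kappa (kappa ξ) = ξ := rfl

theorem contMDiff_tangentBundle_proj {E H M : Type*} [NormedAddCommGroup E] [NormedSpace ℝ E]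
    [TopologicalSpace H] {I : ModelWithCorners ℝ E H} [TopologicalSpace M] [ChartedSpace H M]
    [IsManifold I ∞ M] :
    ContMDiff I.tangent I ∞ (Bundle.TotalSpace.proj : TangentBundle I M → M) :=
  Bundle.contMDiff_proj (TangentSpace I : M → Type _)

theorem contMDiff_π : ContMDiff N.T.I N.I ∞ (π (N := N)) :=
  contMDiff_tangentBundle_proj (I := N.I) (M := N)

theorem continuous_π : Continuous (π (N := N)) := contMDiff_π.continuous

theorem mdifferentiableAt_π (ξ : N.T) : MDifferentiableAt N.T.I N.I π ξ :=
  contMDiff_π.contMDiffAt.mdifferentiableAt (by simp)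

/-- The inverse of the preferred chart of `TTN` over `x₀`. -/
def ttparam (x₀ : N) : (N.E × N.E) × (N.E × N.E) → N.T.T := tparam (N := N.T) (zeroVec x₀)

theorem velocity_tparam_comp [N.I.Boundaryless] {x₀ : N} {c : ℝ → N.E × N.E} {v : N.E × N.E}
    {t : ℝ} (ht : (c t).1 ∈ target x₀) (hc : HasDerivAt c v t) :
    velocity (N := N.T) (fun s => tparam x₀ (c s)) t = ttparam x₀ (c t, v) :=
  velocity_param_comp (N := N.T) (x₀ := zeroVec x₀) (mem_target_T.2 ht) hc

theorem mdifferentiableAt_tparam [N.I.Boundaryless] {x₀ : N} {p : N.E × N.E}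
    (hp : p.1 ∈ target x₀) : MDifferentiableAt 𝓘(ℝ, N.E × N.E) N.T.I (tparam x₀) p :=
  mdifferentiableAt_param (N := N.T) (x₀ := zeroVec x₀) (mem_target_T.2 hp)

theorem hasDerivAt_line {E : Type*} [NormedAddCommGroup E] [NormedSpace ℝ E] (z v : E) (t : ℝ) :
    HasDerivAt (fun s : ℝ => z + s • v) v t := by
  simpa using ((hasDerivAt_id t).smul_const v).const_add z

/-- Exhibits a point of $TTN$ as a mixed second velocity, so that the defining property of $\kappa$
applies: $\partial_b$ at $b=0$ gives $(z+aw,\,v+au)$, and $\partial_a$ of this is $(w,u)$. -/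
theorem ttparam_eq_velocity_velocity [N.I.Boundaryless] {x₀ : N} {z : N.E} (hz : z ∈ target x₀)
    (v w u : N.E) : ttparam x₀ ((z, v), (w, u)) =
      velocity (N := N.T) (fun a => velocity (fun b => param x₀ (z + a • w + b • (v + a • u))) 0)
        0 := by
  have h1 : HasDerivAt (fun a : ℝ => (z + a • w, v + a • u)) (w, u) 0 :=
    (hasDerivAt_line z w 0).prodMk (hasDerivAt_line v u 0)
  have h2 := velocity_tparam_comp (x₀ := x₀) (c := fun a : ℝ => (z + a • w, v + a • u))
    (by simpa using hz) h1
  simp only [zero_smul, add_zero] at h2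
  rw [← h2]
  refine velocity_congr ?_
  have h3 : ContinuousAt (fun a : ℝ => z + a • w) 0 := (hasDerivAt_line z w 0).continuousAt
  filter_upwards [h3.preimage_mem_nhds ((isOpen_target x₀).mem_nhds (by simpa using hz))] with a ha
  have h4 := velocity_param_comp (x₀ := x₀) (c := fun b : ℝ => z + a • w + b • (v + a • u))
    (t := 0) (by simpa using ha) (hasDerivAt_line _ _ 0)
  simpa using h4.symm

/-- The definition of $\kappa$ uses the preferred chart at each base point separately; here the
exchange formula is obtained in one chart for all points over it, from the symmetry of mixed
velocities. -/
theorem kappa_ttparam [N.I.Boundaryless] {x₀ : N} {z : N.E} (hz : z ∈ target x₀)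
    (v w u : N.E) : kappa (ttparam x₀ ((z, v), (w, u))) = ttparam x₀ ((z, w), (v, u)) := by
  have hsm : ContMDiffAt 𝓘(ℝ, ℝ × ℝ) N.I ∞
      (fun p : ℝ × ℝ => param x₀ (z + p.1 • v + p.2 • (w + p.1 • u))) (0, 0) := by
    have h1 : ContMDiffAt 𝓘(ℝ, N.E) N.I ∞ (param x₀)
        (z + (0 : ℝ) • v + (0 : ℝ) • (w + (0 : ℝ) • u)) := by
      simpa using (contMDiffOn_param x₀).contMDiffAt ((isOpen_target x₀).mem_nhds hz)
    have h2 : ContDiff ℝ ∞ (fun p : ℝ × ℝ => z + p.1 • v + p.2 • (w + p.1 • u)) := by fun_prop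
    exact ContMDiffAt.comp (I' := 𝓘(ℝ, N.E)) (0, 0) h1 h2.contMDiff.contMDiffAt
  have h := velocity_velocity_eq_kappa hsm
  have h1 := ttparam_eq_velocity_velocity hz w v u
  have h2 := ttparam_eq_velocity_velocity hz v w u
  refine (congrArg kappa h2).trans (Eq.trans (Eq.trans ?_ h.symm) h1.symm)
  refine congrArg kappa (congrArg (fun c : ℝ → N.T => velocity c 0) ?_)
  funext a
  refine congrArg (fun c : ℝ → N => velocity c 0) ?_
  funext b
  congr 1
  -- Both sides are $z+aw+bv+ab\,u$, with the roles of the two parameters exchanged.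
  module

/-- Near $\xi$ the map is a linear exchange of coordinates in a single fixed chart, by
`kappa_ttparam`. -/
theorem contMDiff_kappa [N.I.Boundaryless] : ContMDiff N.T.T.I N.T.T.I ∞ (kappa (N := N)) := by
  intro ξ
  set x₀ := π (π ξ)
  set e := extChartAt N.T.T.I (zeroVec (N := N.T) (zeroVec x₀)) with he
  have hsrc : ξ ∈ e.source :=
    mem_extChartAt_tangent_source.2 (mem_extChartAt_tangent_source.2 (mem_extChartAt_source x₀))
  have hnhds : e.source ∈ 𝓝 ξ := extChartAt_source_mem_nhds' hsrc
  have htgt : ∀ η ∈ e.source, (e η).1.1 ∈ target x₀ := fun η hη =>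
    mem_target_T.1 (mem_target_T (N := N.T).1 (e.map_source hη))
  have heq : kappa =ᶠ[𝓝 ξ] fun η => ttparam x₀
      (((e η).1.1, (e η).2.1), ((e η).1.2, (e η).2.2)) := by
    filter_upwards [hnhds] with η hη
    have h1 := kappa_ttparam (htgt η hη) (e η).1.2 (e η).2.1 (e η).2.2
    have h2 : ttparam x₀ (((e η).1.1, (e η).1.2), ((e η).2.1, (e η).2.2)) = η := e.left_inv hη
    rw [h2] at h1
    exact h1
  refine ContMDiffAt.congr_of_eventuallyEq ?_ heq
  have h1 : ContMDiffAt N.T.T.I 𝓘(ℝ, N.T.T.E) ∞ e ξ :=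
    contMDiffAt_extChartAt' (by rwa [← extChartAt_source N.T.T.I])
  have h2 : ContDiff ℝ ∞ (fun p : (N.E × N.E) × (N.E × N.E) =>
      ((p.1.1, p.2.1), (p.1.2, p.2.2))) := by fun_prop
  have h3 : ContMDiffAt 𝓘(ℝ, (N.E × N.E) × (N.E × N.E)) N.T.T.I ∞ (ttparam x₀)
      (((e ξ).1.1, (e ξ).2.1), ((e ξ).1.2, (e ξ).2.2)) :=
    (contMDiffOn_param (N := N.T.T) (zeroVec (N := N.T) (zeroVec x₀))).contMDiffAt
      ((isOpen_target (N := N.T.T) _).mem_nhds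
        (mem_target_T (N := N.T).2 (mem_target_T.2 (htgt ξ hsrc))))
  exact ContMDiffAt.comp ξ h3 (ContMDiffAt.comp ξ h2.contMDiff.contMDiffAt h1)

theorem mdifferentiableAt_kappa [N.I.Boundaryless] (ξ : N.T.T) :
    MDifferentiableAt N.T.T.I N.T.T.I kappa ξ :=
  contMDiff_kappa.contMDiffAt.mdifferentiableAt (by simp)

theorem D_kappa_D_kappa [N.I.Boundaryless] (ξ : N.T.T.T) :
    D (kappa (N := N)) (D kappa ξ) = ξ := by
  rw [← D_comp (mdifferentiableAt_kappa _) (mdifferentiableAt_kappa _)]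
  exact D_id ξ

theorem exists_eq_ttparam {x₀ : N} {ξ : N.T.T} (hξ : π (π ξ) ∈ (extChartAt N.I x₀).source) :
    ∃ z ∈ target x₀, ∃ v w u, ξ = ttparam x₀ ((z, v), (w, u)) := by
  set e := extChartAt N.T.T.I (zeroVec (N := N.T) (zeroVec x₀))
  have hsrc : ξ ∈ e.source :=
    mem_extChartAt_tangent_source.2 (mem_extChartAt_tangent_source.2 hξ)
  exact ⟨(e ξ).1.1, mem_target_T.1 (mem_target_T (N := N.T).1 (e.map_source hsrc)),
    (e ξ).1.2, (e ξ).2.1, (e ξ).2.2, (e.left_inv hsrc).symm⟩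

theorem π_ttparam {x₀ : N} {z : N.E} (hz : z ∈ target x₀) (v w u : N.E) :
    π (ttparam x₀ ((z, v), (w, u))) = tparam x₀ (z, v) :=
  π_tparam (N := N.T) (x₀ := zeroVec x₀) (p := ((z, v), (w, u))) (mem_target_T.2 hz)

/-- The tangent map of `π : TN → N` is `π ∘ κ`. -/
theorem D_π_eq [N.I.Boundaryless] (ξ : N.T.T) : D (π (N := N)) ξ = π (kappa ξ) := by
  obtain ⟨x₀, hx₀⟩ : ∃ x₀, π (π ξ) ∈ (extChartAt N.I x₀).source := ⟨_, mem_extChartAt_source _⟩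
  obtain ⟨z, hz, v, w, u, rfl⟩ := exists_eq_ttparam hx₀
  rw [kappa_ttparam hz, π_ttparam hz]
  have h1 : HasDerivAt (fun a : ℝ => (z + a • w, v + a • u)) (w, u) 0 :=
    (hasDerivAt_line z w 0).prodMk (hasDerivAt_line v u 0)
  have h2 := velocity_tparam_comp (x₀ := x₀) (c := fun a : ℝ => (z + a • w, v + a • u))
    (by simpa using hz) h1
  have hz' : (z + (0 : ℝ) • w, v + (0 : ℝ) • u).1 ∈ target x₀ := by simpa using hz
  simp only [zero_smul, add_zero] at h2
  rw [← h2, D_velocity (γ := fun a : ℝ => tparam x₀ (z + a • w, v + a • u)) (mdifferentiableAt_π _)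
    ((mdifferentiableAt_tparam hz').comp 0 h1.differentiableAt.mdifferentiableAt)]
  have h3 : ContinuousAt (fun a : ℝ => z + a • w) 0 := (hasDerivAt_line z w 0).continuousAt
  have h4 : (fun a : ℝ => π (tparam x₀ (z + a • w, v + a • u))) =ᶠ[𝓝 0]
      fun a => param x₀ (z + a • w) := by
    filter_upwards [h3.preimage_mem_nhds ((isOpen_target x₀).mem_nhds (by simpa using hz))] with a ha
    exact π_tparam ha
  rw [velocity_congr h4, velocity_param_comp (by simpa using hz) (hasDerivAt_line z w 0)]
  simp

end SmoothMfd

theorem ContinuousLinearMap.smulRight_one_apply_one {F : Type*} [NormedAddCommGroup F]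
    [NormedSpace ℝ F] (L : ℝ →L[ℝ] F) : (1 : ℝ →L[ℝ] ℝ).smulRight (L 1) = L :=
  ContinuousLinearMap.ext_ring (by simp)

/-! ### Uniqueness of integral curves and the group law -/

namespace SmoothMfd

open Set Filter Topology

variable {N P Q : SmoothMfd.{u}} {X : N → N.T} {U : Set N} {x : N} {J J' : Set ℝ} {γ δ : ℝ → N}

theorem vec_fib_of_π_eq {w : N.T} (h : π w = x) : vec x (show N.E from fib w) = w := by
  subst h
  rfl

theorem IsVectorFieldOn.contMDiffAt_toSection (hX : IsVectorFieldOn X U) (hU : IsOpen U)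
    (hx : x ∈ U) : ContMDiffAt N.I N.I.tangent 1
      (fun y => (⟨y, toSection X y⟩ : TangentBundle N.I N)) x := by
  have h1 : ContMDiffAt N.I N.T.I 1 X x :=
    (hX.1.contMDiffAt (hU.mem_nhds hx)).of_le (by simp)
  refine ContMDiffAt.congr_of_eventuallyEq h1 ?_
  filter_upwards [hU.mem_nhds hx] with y hy
  exact vec_fib_of_π_eq (hX.2 y hy)

namespace IsIntegralCurveFrom

theorem hasMFDerivAt (h : IsIntegralCurveFrom X U x J γ) {t : ℝ} (ht : t ∈ J) :
    HasMFDerivAt 𝓘(ℝ, ℝ) N.I γ t ((1 : ℝ →L[ℝ] ℝ).smulRight (toSection X (γ t))) := by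
  have h1 := (h.mdifferentiableAt t ht).hasMFDerivAt
  have h2 : (mfderiv 𝓘(ℝ, ℝ) N.I γ t (1 : ℝ) : N.E) = toSection X (γ t) :=
    congrArg (fun w : N.T => (show N.E from fib w)) (h.velocity_eq t ht)
  have h3 : mfderiv 𝓘(ℝ, ℝ) N.I γ t = (1 : ℝ →L[ℝ] ℝ).smulRight (toSection X (γ t)) := by
    rw [← h2]
    exact (ContinuousLinearMap.smulRight_one_apply_one (F := N.E) (mfderiv 𝓘(ℝ, ℝ) N.I γ t)).symm
  rwa [h3] at h1

theorem isMIntegralCurveAt (h : IsIntegralCurveFrom X U x J γ) {t : ℝ} (ht : t ∈ J) :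
    IsMIntegralCurveAt γ (toSection X) t := by
  filter_upwards [h.isOpen.mem_nhds ht] with s hs using h.hasMFDerivAt hs

theorem continuousAt (h : IsIntegralCurveFrom X U x J γ) {t : ℝ} (ht : t ∈ J) :
    ContinuousAt γ t := (h.mdifferentiableAt t ht).continuousAt

/-- Agreement of the two curves is an open condition by local uniqueness, and disagreement is open
because $N$ is Hausdorff; the interval $J\cap J'$ is connected and contains $0$. -/
theorem eqOn [N.I.Boundaryless] [T2Space N] (hX : IsVectorFieldOn X U) (hU : IsOpen U)
    (h : IsIntegralCurveFrom X U x J γ) (h' : IsIntegralCurveFrom X U x J' δ) :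
    EqOn γ δ (J ∩ J') := by
  have hpre : IsPreconnected (J ∩ J') := (h.ordConnected.inter h'.ordConnected).isPreconnected
  intro t ht
  refine hpre.induction₂' (fun a b => γ a = δ a → γ b = δ b) (fun a ha => ?_)
    (fun a b c _ _ _ hab hbc hγ => hbc (hab hγ)) ⟨h.zero_mem, h'.zero_mem⟩ ht
    (h.initial.trans h'.initial.symm)
  refine eventually_nhdsWithin_of_eventually_nhds ?_
  by_cases heq : γ a = δ a
  · have h1 := isMIntegralCurveAt_eventuallyEq_of_contMDiffAt_boundaryless
      (hX.contMDiffAt_toSection hU (h.mem a ha.1)) (h.isMIntegralCurveAt ha.1)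
      (h'.isMIntegralCurveAt ha.2) heq
    filter_upwards [h1] with b hb using ⟨fun _ => hb, fun _ => heq⟩
  · have h1 : ∀ᶠ b in 𝓝 a, γ b ≠ δ b :=
      ((h.continuousAt ha.1).prodMk (h'.continuousAt ha.2)).preimage_mem_nhds
        (isClosed_diagonal.isOpen_compl.mem_nhds heq)
    filter_upwards [h1] with b hb using ⟨fun h => absurd h heq, fun h => absurd h hb⟩

theorem mem_flowDomain (h : IsIntegralCurveFrom X U x J γ) {t : ℝ} (ht : t ∈ J) :
    (x, t) ∈ flowDomain X U := ⟨γ, J, h, ht⟩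

/-- By uniqueness, the integral curve chosen in `flow` may be replaced by any other one defined at
time $t$. -/
theorem flow_eq [N.I.Boundaryless] [T2Space N] (hX : IsVectorFieldOn X U) (hU : IsOpen U)
    (h : IsIntegralCurveFrom X U x J γ) {t : ℝ} (ht : t ∈ J) : flow X U t x = γ t := by
  have hd := h.mem_flowDomain ht
  rw [flow, dif_pos hd]
  obtain ⟨K, hK, htK⟩ := hd.choose_spec
  exact hK.eqOn hX hU h ⟨htK, ht⟩

theorem map (h : IsIntegralCurveFrom X U x J γ) {Y : P → P.T} {V : Set P} {f : N → P}
    (hf : ∀ y ∈ U, MDifferentiableAt N.I P.I f y) (hUV : MapsTo f U V)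
    (hXY : ∀ y ∈ U, D f (X y) = Y (f y)) :
    IsIntegralCurveFrom Y V (f x) J (fun t => f (γ t)) where
  isOpen := h.isOpen
  ordConnected := h.ordConnected
  zero_mem := h.zero_mem
  initial := congrArg f h.initial
  mem t ht := hUV (h.mem t ht)
  mdifferentiableAt t ht := (hf _ (h.mem t ht)).comp t (h.mdifferentiableAt t ht)
  velocity_eq t ht := by
    rw [← D_velocity (hf _ (h.mem t ht)) (h.mdifferentiableAt t ht), h.velocity_eq t ht,
      hXY _ (h.mem t ht)]

end IsIntegralCurveFrom

theorem mdifferentiableAt_velocity_comp_add_const {t s : ℝ}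
    (h : MDifferentiableAt 𝓘(ℝ, ℝ) N.I γ (t + s)) :
    MDifferentiableAt 𝓘(ℝ, ℝ) N.I (fun τ => γ (τ + s)) t ∧
      velocity (fun τ => γ (τ + s)) t = velocity γ (t + s) := by
  have h1 : HasDerivAt (fun τ : ℝ => τ + s) 1 t := (hasDerivAt_id t).add_const s
  have h2 : HasMFDerivAt 𝓘(ℝ, ℝ) N.I (fun τ => γ (τ + s)) t _ :=
    HasMFDerivAt.comp t h.hasMFDerivAt h1.hasFDerivAt.hasMFDerivAt
  refine ⟨h2.mdifferentiableAt, ?_⟩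
  unfold velocity
  rw [h2.mfderiv]
  congr 1
  exact congrArg (fun r : ℝ => (mfderiv 𝓘(ℝ, ℝ) N.I γ (t + s) : ℝ → N.E) r) (one_mul (1 : ℝ))

theorem IsIntegralCurveFrom.shift (h : IsIntegralCurveFrom X U x J γ) {s : ℝ} (hs : s ∈ J) :
    IsIntegralCurveFrom X U (γ s) {t | t + s ∈ J} (fun t => γ (t + s)) where
  isOpen := h.isOpen.preimage (by fun_prop)
  ordConnected := ⟨fun a ha b hb c hc =>
    h.ordConnected.out ha hb ⟨by linarith [hc.1], by linarith [hc.2]⟩⟩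
  zero_mem := by simpa using hs
  initial := by simp
  mem t ht := h.mem _ ht
  mdifferentiableAt t ht := (mdifferentiableAt_velocity_comp_add_const (h.mdifferentiableAt _ ht)).1
  velocity_eq t ht := (mdifferentiableAt_velocity_comp_add_const
    (h.mdifferentiableAt _ ht)).2.trans (h.velocity_eq _ ht)

/-- Concatenation of integral curves, and the group law of the flow. -/
theorem flow_add [N.I.Boundaryless] [T2Space N] (hX : IsVectorFieldOn X U) (hU : IsOpen U)
    {s t : ℝ} (hs : (x, s) ∈ flowDomain X U) (ht : (flow X U s x, t) ∈ flowDomain X U) :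
    (x, s + t) ∈ flowDomain X U ∧ flow X U (s + t) x = flow X U t (flow X U s x) := by
  classical
  obtain ⟨γ, J, hγ, hsJ⟩ := hs
  have hfs := hγ.flow_eq hX hU hsJ
  rw [hfs] at ht
  obtain ⟨δ, K, hδ, htK⟩ := ht
  simp only at hγ hδ hsJ htK
  have hδ' : IsIntegralCurveFrom X U (γ s) K δ := hδ
  set δ' : ℝ → N := fun τ => δ (τ + -s)
  have hag : ∀ τ ∈ J, τ + -s ∈ K → γ τ = δ' τ := by
    intro τ hτ hτK
    have := (hγ.shift hsJ).eqOn hX hU hδ ⟨by simpa using hτ, hτK⟩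
    simpa using this
  have hmK : ∀ τ, τ + -s ∈ K → MDifferentiableAt 𝓘(ℝ, ℝ) N.I δ' τ ∧ velocity δ' τ = X (δ' τ) :=
    fun τ hτ => ⟨(mdifferentiableAt_velocity_comp_add_const (hδ.mdifferentiableAt _ hτ)).1,
      (mdifferentiableAt_velocity_comp_add_const (hδ.mdifferentiableAt _ hτ)).2.trans
        (hδ.velocity_eq _ hτ)⟩
  -- The concatenation: $\gamma$ on $J$ and the shifted $\delta$ elsewhere. They agree on the
  -- overlap, so near each time $\eta$ coincides with one of two integral curves.
  set η : ℝ → N := fun τ => if τ ∈ J then γ τ else δ' τ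
  have hη1 : ∀ τ ∈ J, η τ = γ τ := fun τ hτ => if_pos hτ
  have hη2 : ∀ τ, τ + -s ∈ K → η τ = δ' τ := by
    intro τ hτ
    by_cases hJ : τ ∈ J
    · rw [hη1 τ hJ, hag τ hJ hτ]
    · exact if_neg hJ
  have hKo : IsOpen {τ | τ + -s ∈ K} := hδ.isOpen.preimage (by fun_prop)
  have hev1 : ∀ τ ∈ J, η =ᶠ[𝓝 τ] γ := fun τ hτ => by
    filter_upwards [hγ.isOpen.mem_nhds hτ] with σ hσ using hη1 σ hσ
  have hev2 : ∀ τ, τ + -s ∈ K → η =ᶠ[𝓝 τ] δ' := fun τ hτ => by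
    filter_upwards [hKo.mem_nhds hτ] with σ hσ using hη2 σ hσ
  have hconn : (J ∪ {τ | τ + -s ∈ K}).OrdConnected := by
    rw [← isPreconnected_iff_ordConnected]
    refine IsPreconnected.union s hsJ (by simpa using hδ.zero_mem) hγ.ordConnected.isPreconnected ?_
    refine Set.OrdConnected.isPreconnected ⟨fun a ha b hb c hc => ?_⟩
    exact hδ.ordConnected.out ha hb ⟨by linarith [hc.1], by linarith [hc.2]⟩
  have hcurve : IsIntegralCurveFrom X U x (J ∪ {τ | τ + -s ∈ K}) η :=
    { isOpen := hγ.isOpen.union hKo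
      ordConnected := hconn
      zero_mem := Or.inl hγ.zero_mem
      initial := (hη1 0 hγ.zero_mem).trans hγ.initial
      mem := by
        rintro τ (hτ | hτ)
        · rw [hη1 τ hτ]; exact hγ.mem τ hτ
        · rw [hη2 τ hτ]; exact hδ.mem _ hτ
      mdifferentiableAt := by
        rintro τ (hτ | hτ)
        · exact (hγ.mdifferentiableAt τ hτ).congr_of_eventuallyEq (hev1 τ hτ)
        · exact (hmK τ hτ).1.congr_of_eventuallyEq (hev2 τ hτ)
      velocity_eq := by
        rintro τ (hτ | hτ)
        · rw [velocity_congr (hev1 τ hτ), hη1 τ hτ]; exact hγ.velocity_eq τ hτ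
        · rw [velocity_congr (hev2 τ hτ), hη2 τ hτ]; exact (hmK τ hτ).2 }
  have hst : s + t + -s ∈ K := by simpa using htK
  refine ⟨hcurve.mem_flowDomain (Or.inr hst), ?_⟩
  rw [hcurve.flow_eq hX hU (Or.inr hst), hη2 _ hst, hfs, hδ.flow_eq hX hU htK]
  change δ (s + t + -s) = δ t
  congr 1
  ring

/-- Related vector fields have related flows. -/
theorem flow_map [P.I.Boundaryless] [T2Space P] [N.I.Boundaryless] [T2Space N]
    (hX : IsVectorFieldOn X U) (hU : IsOpen U) {Y : P → P.T} {V : Set P} (hY : IsVectorFieldOn Y V)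
    (hV : IsOpen V) {f : N → P} (hf : ∀ y ∈ U, MDifferentiableAt N.I P.I f y) (hUV : MapsTo f U V)
    (hXY : ∀ y ∈ U, D f (X y) = Y (f y)) {t : ℝ} (h : (x, t) ∈ flowDomain X U) :
    (f x, t) ∈ flowDomain Y V ∧ flow Y V t (f x) = f (flow X U t x) := by
  obtain ⟨γ, J, hγ, ht⟩ := h
  have h1 := hγ.map hf hUV hXY
  exact ⟨h1.mem_flowDomain ht, by rw [h1.flow_eq hY hV ht, hγ.flow_eq hX hU ht]⟩

end SmoothMfd

/-! ### The tangent lift and its local flow -/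

namespace SmoothMfd

open Set Filter Topology

variable {N P : SmoothMfd.{u}} {X : N → N.T} {U : Set N}

theorem contMDiffOn_tangentMap_of_isOpen {E H M E' H' M' : Type*} [NormedAddCommGroup E]
    [NormedSpace ℝ E] [TopologicalSpace H] {I : ModelWithCorners ℝ E H} [TopologicalSpace M]
    [ChartedSpace H M] [IsManifold I ∞ M] [NormedAddCommGroup E'] [NormedSpace ℝ E']
    [TopologicalSpace H'] {I' : ModelWithCorners ℝ E' H'} [TopologicalSpace M'] [ChartedSpace H' M']
    [IsManifold I' ∞ M'] {f : M → M'} {s : Set M} (hf : ContMDiffOn I I' ∞ f s) (hs : IsOpen s) :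
    ContMDiffOn I.tangent I'.tangent ∞ (tangentMap I I' f) (Bundle.TotalSpace.proj ⁻¹' s) := by
  refine (hf.contMDiffOn_tangentMapWithin (m := ∞) (by simp) hs.uniqueMDiffOn).congr fun ξ hξ => ?_
  exact (tangentMapWithin_eq_tangentMap (hs.uniqueMDiffOn _ hξ)
    ((hf.contMDiffAt (hs.mem_nhds hξ)).mdifferentiableAt (by simp))).symm

theorem contMDiffOn_D {f : N → P} (hf : ContMDiffOn N.I P.I ∞ f U) (hU : IsOpen U) :
    ContMDiffOn N.T.I P.T.I ∞ (D f) (π ⁻¹' U) :=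
  contMDiffOn_tangentMap_of_isOpen hf hU

theorem IsVectorFieldOn.mdifferentiableAt (hX : IsVectorFieldOn X U) (hU : IsOpen U) {x : N}
    (hx : x ∈ U) : MDifferentiableAt N.I N.T.I X x :=
  (hX.1.contMDiffAt (hU.mem_nhds hx)).mdifferentiableAt (by simp)

/-- The tangent lift `κ ∘ DX` of a vector field `X` on `N` to `TN`. -/
def tangentLift (X : N → N.T) : N.T → N.T.T := fun ξ => kappa (D X ξ)

/-- $DX$ lies over $X$ and not over the identity, but $D\pi\circ DX = D(\pi\circ X)=\mathrm{id}$;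
since $D\pi=\pi\circ\kappa$, applying $\kappa$ gives a section. -/
theorem IsVectorFieldOn.tangentLift [N.I.Boundaryless] (hX : IsVectorFieldOn X U) (hU : IsOpen U) :
    IsVectorFieldOn (tangentLift X) (π ⁻¹' U) := by
  refine ⟨contMDiff_kappa.comp_contMDiffOn (contMDiffOn_D hX.1 hU), fun ξ hξ => ?_⟩
  have h1 : (fun y => π (X y)) =ᶠ[𝓝 (π ξ)] fun y => y := by
    filter_upwards [hU.mem_nhds hξ] with y hy using hX.2 y hy
  calc π (kappa (D X ξ)) = D π (D X ξ) := (D_π_eq _).symm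
    _ = D (fun y => π (X y)) ξ := (D_comp (mdifferentiableAt_π _) (hX.mdifferentiableAt hU hξ)).symm
    _ = ξ := (D_congr h1).trans (D_id ξ)

/-- The principal part of a vector field in the preferred chart at `x₀`. -/
def principalPart (X : N → N.T) (x₀ : N) (z : N.E) : N.E :=
  (show N.E × N.E from extChartAt N.T.I (zeroVec x₀) (X (param x₀ z))).2

/-- The part of the range of the preferred chart at `x₀` which lies over `U`. -/
def targetOver (U : Set N) (x₀ : N) : Set N.E := target x₀ ∩ param x₀ ⁻¹' U

theorem isOpen_targetOver [N.I.Boundaryless] (hU : IsOpen U) (x₀ : N) :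
    IsOpen (targetOver U x₀) :=
  (contMDiffOn_param x₀).continuousOn.isOpen_inter_preimage (isOpen_target x₀) hU

theorem param_mem_source {x₀ : N} {z : N.E} (hz : z ∈ target x₀) :
    param x₀ z ∈ (extChartAt N.I x₀).source := (extChartAt N.I x₀).map_target hz

theorem contDiffAt_principalPart [N.I.Boundaryless] (hX : IsVectorFieldOn X U) (hU : IsOpen U)
    {x₀ : N} {z : N.E} (hz : z ∈ targetOver U x₀) : ContDiffAt ℝ ∞ (principalPart X x₀) z := by
  have h1 : ContMDiffAt 𝓘(ℝ, N.E) N.I ∞ (param x₀) z :=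
    (contMDiffOn_param x₀).contMDiffAt ((isOpen_target x₀).mem_nhds hz.1)
  have h2 : ContMDiffAt N.I N.T.I ∞ X (param x₀ z) := hX.1.contMDiffAt (hU.mem_nhds hz.2)
  have hsrc : X (param x₀ z) ∈ (extChartAt N.T.I (zeroVec x₀)).source := by
    refine mem_extChartAt_tangent_source.2 ?_
    change π (X (param x₀ z)) ∈ (extChartAt N.I x₀).source
    rw [hX.2 _ hz.2]
    exact param_mem_source hz.1
  have h3 : ContMDiffAt N.T.I 𝓘(ℝ, N.T.E) ∞ (extChartAt N.T.I (zeroVec x₀)) (X (param x₀ z)) :=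
    contMDiffAt_extChartAt' (by rwa [← extChartAt_source N.T.I])
  have h4 := ContMDiffAt.comp z h3 (ContMDiffAt.comp z h2 h1)
  exact contDiffAt_snd.comp z h4.contDiffAt

theorem apply_param [N.I.Boundaryless] (hX : IsVectorFieldOn X U)
    {x₀ : N} {z : N.E} (hz : z ∈ targetOver U x₀) :
    X (param x₀ z) = tparam x₀ (z, principalPart X x₀ z) := by
  have hπ := hX.2 _ hz.2
  have hsrc : X (param x₀ z) ∈ (extChartAt N.T.I (zeroVec x₀)).source := by
    refine mem_extChartAt_tangent_source.2 ?_
    change π (X (param x₀ z)) ∈ (extChartAt N.I x₀).source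
    rw [hπ]
    exact param_mem_source hz.1
  have h1 : (show N.E × N.E from extChartAt N.T.I (zeroVec x₀) (X (param x₀ z))).1 = z := by
    change extChartAt N.I x₀ (π (X (param x₀ z))) = z
    rw [hπ]
    exact (extChartAt N.I x₀).right_inv hz.1
  have h2 : tparam x₀ (extChartAt N.T.I (zeroVec x₀) (X (param x₀ z))) = X (param x₀ z) :=
    (extChartAt N.T.I (zeroVec x₀)).left_inv hsrc
  rw [← h2]
  congr 1
  exact Prod.ext h1 rfl

/-- Differentiating $X$ along the line $z+av$ gives $((z,f),(v,Df\,v))$, and $\kappa$ exchanges the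
middle entries. Integral curves of the lift thus solve the equation together with its linearization.
-/
theorem tangentLift_tparam [N.I.Boundaryless] (hX : IsVectorFieldOn X U) (hU : IsOpen U)
    {x₀ : N} {z : N.E} (hz : z ∈ targetOver U x₀) (v : N.E) :
    tangentLift X (tparam x₀ (z, v)) = ttparam x₀ ((z, v),
      (principalPart X x₀ z, fderiv ℝ (principalPart X x₀) z v)) := by
  have hl : HasDerivAt (fun a : ℝ => z + a • v) v 0 := hasDerivAt_line z v 0
  have hz0 : z + (0 : ℝ) • v = z := by simp
  have hz1 : z + (0 : ℝ) • v ∈ targetOver U x₀ := by rwa [hz0]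
  have h1 := velocity_param_comp (x₀ := x₀) (c := fun a : ℝ => z + a • v) hz1.1 hl
  have hf : HasDerivAt (fun a : ℝ => principalPart X x₀ (z + a • v))
      (fderiv ℝ (principalPart X x₀) (z + (0 : ℝ) • v) v) 0 := by
    have h := ((contDiffAt_principalPart hX hU hz1).differentiableAt (by simp)).hasFDerivAt
    exact h.comp_hasDerivAt (0 : ℝ) hl
  have h2 : (fun a : ℝ => X (param x₀ (z + a • v))) =ᶠ[𝓝 0] fun a =>
      tparam x₀ (z + a • v, principalPart X x₀ (z + a • v)) := by
    filter_upwards [hl.continuousAt.preimage_mem_nhds ((isOpen_targetOver hU x₀).mem_nhds hz1)]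
      with a ha using apply_param hX ha
  have h3 := velocity_tparam_comp (x₀ := x₀)
    (c := fun a : ℝ => (z + a • v, principalPart X x₀ (z + a • v))) hz1.1 (hl.prodMk hf)
  have h4 : D X (tparam x₀ (z, v)) = ttparam x₀ ((z, principalPart X x₀ z),
      (v, fderiv ℝ (principalPart X x₀) z v)) := by
    rw [hz0] at h1
    rw [← h1, D_velocity (γ := fun a : ℝ => param x₀ (z + a • v)) (hX.mdifferentiableAt hU hz1.2)
      ((mdifferentiableAt_param hz1.1).comp 0 hl.differentiableAt.mdifferentiableAt),
      velocity_congr h2, h3, hz0]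
  rw [SmoothMfd.tangentLift, h4, kappa_ttparam hz.1]

/-- At time `t`, the flow of `X` is defined and differentiable at `y`, and its tangent map at `y` is
the flow of the tangent lift of `X`. -/
structure RegularFlowAt (X : N → N.T) (U : Set N) (t : ℝ) (y : N) : Prop where
  mem : (y, t) ∈ flowDomain X U
  mdifferentiableAt : MDifferentiableAt N.I N.I (flow X U t) y
  mem_lift : ∀ ξ : N.T, π ξ = y → (ξ, t) ∈ flowDomain (tangentLift X) (π ⁻¹' U)
  flow_lift : ∀ ξ : N.T, π ξ = y → flow (tangentLift X) (π ⁻¹' U) t ξ = D (flow X U t) ξ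

/-- In a chart, one operator $A$ plays both roles: $t\mapsto(\varphi(z,t),A(z,t)v)$ is an integral
curve of the lift, and $A(z,t)$ is the derivative of the flow at $z$. The time bound is common to
all nearby points. -/
theorem exists_eventually_regularFlowAt [N.I.Boundaryless] [T2Space N] [CompleteSpace N.E]
    (hX : IsVectorFieldOn X U) (hU : IsOpen U) {x : N} (hx : x ∈ U) :
    ∃ ε > 0, ∀ᶠ y in 𝓝 x, ∀ t ∈ Ioo (-ε) ε, RegularFlowAt X U t y := by
  set e := extChartAt N.I x with he
  set f := principalPart X x with hf
  have hz₀ : e x ∈ targetOver U x := by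
    refine ⟨mem_extChartAt_target x, ?_⟩
    change e.symm (e x) ∈ U
    rwa [e.left_inv (mem_extChartAt_source x)]
  obtain ⟨ρ, hρ, ε, hε, φ, A, hφ⟩ := ((contDiffAt_principalPart hX hU hz₀).of_le
    (m := 2) (by exact ENat.LEInfty.out)).exists_local_flow_hasFDerivAt
      ((isOpen_targetOver hU x).mem_nhds hz₀)
  set W : Set N := e.source ∩ e ⁻¹' Metric.ball (e x) ρ with hWdef
  have hWo : IsOpen W := (continuousOn_extChartAt (I := N.I) x).isOpen_inter_preimage
    (isOpen_extChartAt_source x) Metric.isOpen_ball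
  have hxW : x ∈ W := ⟨mem_extChartAt_source x, Metric.mem_ball_self hρ⟩
  have hIoo : IsOpen (Ioo (-ε) ε) := isOpen_Ioo
  have h0 : (0 : ℝ) ∈ Ioo (-ε) ε := ⟨by linarith, hε⟩
  have hpe : ∀ y ∈ W, param x (e y) = y := fun y hy => e.left_inv hy.1
  have hcurve : ∀ y ∈ W, IsIntegralCurveFrom X U y (Ioo (-ε) ε) (fun t => param x (φ (e y) t)) := by
    intro y hy
    obtain ⟨hφ0, -, hφt⟩ := hφ (e y) hy.2
    exact
      { isOpen := hIoo
        ordConnected := ordConnected_Ioo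
        zero_mem := h0
        initial := by rw [hφ0, hpe y hy]
        mem := fun t ht => (hφt t ht).1.2
        mdifferentiableAt := fun t ht => (mdifferentiableAt_param (hφt t ht).1.1).comp t
          (hφt t ht).2.1.differentiableAt.mdifferentiableAt
        velocity_eq := fun t ht => by
          rw [velocity_param_comp (hφt t ht).1.1 (hφt t ht).2.1, apply_param hX (hφt t ht).1] }
  have hflow : ∀ t ∈ Ioo (-ε) ε, ∀ y ∈ W, flow X U t y = param x (φ (e y) t) := fun t ht y hy =>
    (hcurve y hy).flow_eq hX hU ht
  have hlift : ∀ y ∈ W, ∀ v : N.E, IsIntegralCurveFrom (tangentLift X) (π ⁻¹' U)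
      (tparam x (e y, v)) (Ioo (-ε) ε) (fun t => tparam x (φ (e y) t, A (e y) t v)) := by
    intro y hy v
    obtain ⟨hφ0, hA0, hφt⟩ := hφ (e y) hy.2
    have hder : ∀ t ∈ Ioo (-ε) ε, HasDerivAt (fun t => (φ (e y) t, A (e y) t v))
        (f (φ (e y) t), fderiv ℝ f (φ (e y) t) (A (e y) t v)) t := fun t ht => by
      refine (hφt t ht).2.1.prodMk ?_
      simpa using (hφt t ht).2.2.1.clm_apply (hasDerivAt_const t v)
    exact
      { isOpen := hIoo
        ordConnected := ordConnected_Ioo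
        zero_mem := h0
        initial := by rw [hφ0, hA0]; rfl
        mem := fun t ht => by
          rw [mem_preimage, π_tparam (hφt t ht).1.1]
          exact (hφt t ht).1.2
        mdifferentiableAt := fun t ht => (mdifferentiableAt_tparam (hφt t ht).1.1).comp t
          (hder t ht).differentiableAt.mdifferentiableAt
        velocity_eq := fun t ht => by
          rw [velocity_tparam_comp (c := fun t => (φ (e y) t, A (e y) t v)) (hφt t ht).1.1
            (hder t ht), tangentLift_tparam hX hU (hφt t ht).1] }
  refine ⟨ε, hε, ?_⟩
  filter_upwards [hWo.mem_nhds hxW] with y hy t ht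
  obtain ⟨hφ0, hA0, hφt⟩ := hφ (e y) hy.2
  have hdiff : MDifferentiableAt N.I N.I (flow X U t) y := by
    have h1 : MDifferentiableAt N.I 𝓘(ℝ, N.E) e y :=
      mdifferentiableAt_extChartAt (by rw [← extChartAt_source N.I]; exact hy.1)
    have h2 : MDifferentiableAt 𝓘(ℝ, N.E) 𝓘(ℝ, N.E) (fun z => φ z t) (e y) :=
      (hφt t ht).2.2.2.differentiableAt.mdifferentiableAt
    refine MDifferentiableAt.congr_of_eventuallyEq ?_
      (Filter.eventually_of_mem (hWo.mem_nhds hy) fun y' hy' => hflow t ht y' hy')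
    exact MDifferentiableAt.comp y (mdifferentiableAt_param (hφt t ht).1.1) (h2.comp y h1)
  have hξ : ∀ ξ : N.T, π ξ = y → ∃ v : N.E, ξ = tparam x (e y, v) := by
    rintro ξ rfl
    exact ⟨_, (tparam_chart hy.1).symm⟩
  have hyt : e y ∈ target x := e.map_source hy.1
  refine ⟨(hcurve y hy).mem_flowDomain ht, hdiff, fun ξ h => ?_, fun ξ h => ?_⟩
  · obtain ⟨v, rfl⟩ := hξ ξ h
    exact (hlift y hy v).mem_flowDomain ht
  · obtain ⟨v, rfl⟩ := hξ ξ h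
    rw [(hlift y hy v).flow_eq (hX.tangentLift hU) (hU.preimage continuous_π) ht]
    -- The tangent map of the flow is evaluated on $\xi$ by following the image of the coordinate
    -- line through $e(y)$ with direction $v$.
    have hl : HasDerivAt (fun a : ℝ => e y + a • v) v 0 := hasDerivAt_line _ v 0
    have hz0 : e y + (0 : ℝ) • v = e y := by simp
    have hyt' : e y + (0 : ℝ) • v ∈ target x := by rwa [hz0]
    have h1 := velocity_param_comp (x₀ := x) (c := fun a : ℝ => e y + a • v) hyt' hl
    rw [hz0] at h1
    have hev : (fun a : ℝ => flow X U t (param x (e y + a • v))) =ᶠ[𝓝 0]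
        fun a => param x (φ (e y + a • v) t) := by
      have hnh : target x ∩ Metric.ball (e x) ρ ∈ 𝓝 (e y + (0 : ℝ) • v) := by
        rw [hz0]
        exact ((isOpen_target x).inter Metric.isOpen_ball).mem_nhds ⟨hyt, hy.2⟩
      filter_upwards [hl.continuousAt.preimage_mem_nhds hnh] with a ha
      have hr : e (param x (e y + a • v)) = e y + a • v := e.right_inv ha.1
      have hmem : param x (e y + a • v) ∈ W := ⟨e.map_target ha.1, by
        rw [mem_preimage, hr]; exact ha.2⟩
      rw [hflow t ht _ hmem, hr]
    have hd : HasDerivAt (fun a : ℝ => φ (e y + a • v) t) (A (e y) t v) 0 := by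
      have h2 := (hφt t ht).2.2.2
      rw [← hz0] at h2
      have h3 := h2.comp_hasDerivAt (0 : ℝ) hl
      rwa [hz0] at h3
    have hd' : φ (e y + (0 : ℝ) • v) t ∈ target x := by
      rw [hz0]; exact (hφt t ht).1.1
    have hdiff' : MDifferentiableAt N.I N.I (flow X U t) (param x (e y + (0 : ℝ) • v)) := by
      rwa [hz0, hpe y hy]
    rw [← h1, D_velocity (γ := fun a : ℝ => param x (e y + a • v)) hdiff'
      ((mdifferentiableAt_param hyt').comp 0 hl.differentiableAt.mdifferentiableAt),
      velocity_congr hev, velocity_param_comp (c := fun a : ℝ => φ (e y + a • v) t) hd' hd,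
      hz0]

end SmoothMfd

namespace SmoothMfd

open Set Filter Topology

/-! ### The flow of the tangent lift for all times -/

section TangentLiftFlow

variable {N : SmoothMfd.{u}} [N.I.Boundaryless] [T2Space N] {X : N → N.T} {U : Set N}

/-- The chain rule applied to $\phi_{s+t}=\phi_t\circ\phi_s$. To be differentiated, this identity
must hold on a neighbourhood, so regularity is carried for all nearby points. -/
theorem RegularFlowAt.add (hX : IsVectorFieldOn X U) (hU : IsOpen U) {s t : ℝ} {x : N}
    (hs : ∀ᶠ y in 𝓝 x, RegularFlowAt X U s y)
    (ht : ∀ᶠ y in 𝓝 (flow X U s x), RegularFlowAt X U t y) :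
    ∀ᶠ y in 𝓝 x, RegularFlowAt X U (s + t) y := by
  have hc : ContinuousAt (flow X U s) x := hs.self_of_nhds.mdifferentiableAt.continuousAt
  have hboth : ∀ᶠ y in 𝓝 x, RegularFlowAt X U s y ∧ RegularFlowAt X U t (flow X U s y) :=
    hs.and (hc.eventually ht)
  filter_upwards [hboth.eventually_nhds] with y hy
  obtain ⟨h1, h2⟩ := hy.self_of_nhds
  have heq : flow X U (s + t) =ᶠ[𝓝 y] fun z => flow X U t (flow X U s z) := by
    filter_upwards [hy] with z hz using (flow_add hX hU hz.1.mem hz.2.mem).2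
  have hlift : ∀ ξ : N.T, π ξ = y →
      (flow (tangentLift X) (π ⁻¹' U) s ξ, t) ∈ flowDomain (tangentLift X) (π ⁻¹' U) := by
    intro ξ hξ
    refine h2.mem_lift _ ?_
    rw [h1.flow_lift ξ hξ, π_D, hξ]
  refine ⟨(flow_add hX hU h1.mem h2.mem).1,
    (MDifferentiableAt.comp y h2.mdifferentiableAt h1.mdifferentiableAt).congr_of_eventuallyEq heq,
    fun ξ hξ => (flow_add (hX.tangentLift hU) (hU.preimage continuous_π) (h1.mem_lift ξ hξ)
      (hlift ξ hξ)).1, fun ξ hξ => ?_⟩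
  rw [(flow_add (hX.tangentLift hU) (hU.preimage continuous_π) (h1.mem_lift ξ hξ)
      (hlift ξ hξ)).2, h1.flow_lift ξ hξ, h2.flow_lift _ (by rw [π_D, hξ])]
  subst hξ
  rw [D_congr heq, D_comp h2.mdifferentiableAt h1.mdifferentiableAt]

/-- Regularity near $x$ passes between close times of the integral curve, and the interval $J$ is
connected, so it spreads from time $0$ to time $t$. -/
theorem regularFlowAt_of_mem [CompleteSpace N.E] (hX : IsVectorFieldOn X U) (hU : IsOpen U)
    {t : ℝ} {x : N} (h : (x, t) ∈ flowDomain X U) : RegularFlowAt X U t x := by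
  obtain ⟨γ, J, hγ, ht⟩ := h
  simp only at hγ ht
  have hflow : ∀ s ∈ J, flow X U s x = γ s := fun s hs => hγ.flow_eq hX hU hs
  have hx : x ∈ U := by
    have := hγ.mem 0 hγ.zero_mem
    rwa [hγ.initial] at this
  have h0 : ∀ᶠ y in 𝓝 x, RegularFlowAt X U 0 y := by
    obtain ⟨ε, hε, h⟩ := exists_eventually_regularFlowAt hX hU hx
    filter_upwards [h] with y hy using hy 0 ⟨by linarith, hε⟩
  have hstep : ∀ a ∈ J, ∀ b, (∀ᶠ y in 𝓝 (γ a), RegularFlowAt X U (b - a) y) →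
      (∀ᶠ y in 𝓝 x, RegularFlowAt X U a y) → ∀ᶠ y in 𝓝 x, RegularFlowAt X U b y := by
    intro a ha b h1 h2
    rw [← hflow a ha] at h1
    simpa using RegularFlowAt.add hX hU h2 h1
  refine (hγ.ordConnected.isPreconnected.induction₂'
    (fun a b => (∀ᶠ y in 𝓝 x, RegularFlowAt X U a y) → ∀ᶠ y in 𝓝 x, RegularFlowAt X U b y)
    (fun a ha => ?_) (fun a b c _ _ _ hab hbc h => hbc (hab h)) hγ.zero_mem ht h0).self_of_nhds
  obtain ⟨ε, hε, hloc⟩ := exists_eventually_regularFlowAt hX hU (hγ.mem a ha)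
  have hball : ∀ᶠ b in 𝓝 a, b - a ∈ Ioo (-ε) ε := by
    have hc : Continuous fun b : ℝ => b - a := by fun_prop
    exact hc.continuousAt.preimage_mem_nhds (Ioo_mem_nhds (by simpa using hε) (by simpa using hε))
  -- The transfer is needed in both directions. The local bound around $\gamma(a)$ also holds around
  -- $\gamma(b)$ for $b$ near $a$, which allows the backward step by $a-b$.
  filter_upwards [nhdsWithin_le_nhds hball, self_mem_nhdsWithin, nhdsWithin_le_nhds
    ((hγ.continuousAt ha).eventually hloc.eventually_nhds)] with b hb hbJ hbloc
  refine ⟨hstep a ha b (hloc.mono fun y hy => hy _ hb), hstep b hbJ a (hbloc.mono fun y hy =>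
    hy _ ⟨by linarith [hb.2], by linarith [hb.1]⟩)⟩

/-- One direction projects integral curves by $\pi$, using $D\pi\circ\kappa\circ DX = X\circ\pi$;
the other says that the linearized equation lives as long as the base curve. -/
theorem mem_flowDomain_tangentLift_iff [CompleteSpace N.E] (hX : IsVectorFieldOn X U)
    (hU : IsOpen U) {t : ℝ} {ξ : N.T} :
    (ξ, t) ∈ flowDomain (tangentLift X) (π ⁻¹' U) ↔ (π ξ, t) ∈ flowDomain X U := by
  refine ⟨fun h => ?_, fun h => (regularFlowAt_of_mem hX hU h).mem_lift ξ rfl⟩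
  refine (flow_map (hX.tangentLift hU) (hU.preimage continuous_π) hX hU
    (fun y _ => mdifferentiableAt_π y) (mapsTo_preimage _ _) (fun η hη => ?_) h).1
  have h1 := (hX.tangentLift hU).2 η hη
  change D π (kappa (D X η)) = X (π η)
  rw [D_π_eq, kappa_kappa, π_D]

end TangentLiftFlow

/-! ### The complete lift as a conjugate of the tangent lift -/

section CompleteLift

theorem completeLift_eq {N : SmoothMfd.{u}} (S : N.T → N.T.T) (ξ : N.T.T) :
    completeLift S ξ = D kappa (tangentLift S (kappa ξ)) := rfl

variable {N : SmoothMfd.{u}} [N.I.Boundaryless] {S : N.T → N.T.T} {U : Set N.T}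

theorem continuous_kappa : Continuous (kappa (N := N)) := contMDiff_kappa.continuous

theorem IsVectorFieldOn.completeLift (hS : IsVectorFieldOn S U) (hU : IsOpen U) :
    IsVectorFieldOn (completeLift S) (kappa ⁻¹' (π ⁻¹' U)) := by
  have h := hS.tangentLift hU
  refine ⟨?_, fun ξ hξ => ?_⟩
  · have h1 : ContMDiffOn N.T.T.T.I N.T.T.T.I ∞ (D (kappa (N := N))) (π ⁻¹' univ) :=
      contMDiffOn_D contMDiff_kappa.contMDiffOn isOpen_univ
    have h2 : ContMDiff N.T.T.T.I N.T.T.T.I ∞ (D (kappa (N := N))) := contMDiffOn_univ.1 h1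
    exact h2.comp_contMDiffOn (h.1.comp contMDiff_kappa.contMDiffOn (fun ξ hξ => hξ))
  · rw [completeLift_eq, π_D, h.2 _ hξ, kappa_kappa]

variable [T2Space N]

/-- The two fields are $\kappa$-related because $\kappa\circ\kappa=\mathrm{id}$; the reverse
relation, from $D\kappa\circ D\kappa=\mathrm{id}$, transports domains back. -/
theorem flow_completeLift_of_mem_tangentLift (hS : IsVectorFieldOn S U) (hU : IsOpen U) {t : ℝ}
    {ξ : N.T.T} (h : (ξ, t) ∈ flowDomain (tangentLift S) (π ⁻¹' U)) :
    (kappa ξ, t) ∈ flowDomain (completeLift S) (kappa ⁻¹' (π ⁻¹' U)) ∧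
      flow (completeLift S) (kappa ⁻¹' (π ⁻¹' U)) t (kappa ξ) =
        kappa (flow (tangentLift S) (π ⁻¹' U) t ξ) :=
  flow_map (hS.tangentLift hU) (hU.preimage continuous_π) (hS.completeLift hU)
    ((hU.preimage continuous_π).preimage continuous_kappa) (fun y _ => mdifferentiableAt_kappa y)
    (fun η hη => hη) (fun η _ => by rw [completeLift_eq, kappa_kappa]) h

theorem mem_flowDomain_tangentLift_of_completeLift (hS : IsVectorFieldOn S U) (hU : IsOpen U)
    {t : ℝ} {ξ : N.T.T} (h : (ξ, t) ∈ flowDomain (completeLift S) (kappa ⁻¹' (π ⁻¹' U))) :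
    (kappa ξ, t) ∈ flowDomain (tangentLift S) (π ⁻¹' U) :=
  (flow_map (hS.completeLift hU) ((hU.preimage continuous_π).preimage continuous_kappa)
    (hS.tangentLift hU) (hU.preimage continuous_π) (fun y _ => mdifferentiableAt_kappa y)
    (fun η hη => hη) (fun η _ => by rw [completeLift_eq, D_kappa_D_kappa]) h).1

theorem mem_flowDomain_completeLift_iff [CompleteSpace N.E] (hS : IsVectorFieldOn S U)
    (hU : IsOpen U) {t : ℝ} {ξ : N.T.T} :
    (ξ, t) ∈ flowDomain (completeLift S) (kappa ⁻¹' (π ⁻¹' U)) ↔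
      (π (kappa ξ), t) ∈ flowDomain S U := by
  rw [← mem_flowDomain_tangentLift_iff hS hU]
  refine ⟨mem_flowDomain_tangentLift_of_completeLift hS hU, fun h => ?_⟩
  simpa using (flow_completeLift_of_mem_tangentLift hS hU h).1

theorem flow_completeLift [CompleteSpace N.E] (hS : IsVectorFieldOn S U) (hU : IsOpen U) {t : ℝ}
    {ξ : N.T.T} (h : (ξ, t) ∈ flowDomain (completeLift S) (kappa ⁻¹' (π ⁻¹' U))) :
    MDifferentiableAt N.T.I N.T.I (flow S U t) (π (kappa ξ)) ∧
      flow (completeLift S) (kappa ⁻¹' (π ⁻¹' U)) t ξ = kappa (D (flow S U t) (kappa ξ)) := by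
  have hr := regularFlowAt_of_mem hS hU ((mem_flowDomain_completeLift_iff hS hU).1 h)
  refine ⟨hr.mdifferentiableAt, ?_⟩
  rw [← hr.flow_lift (kappa ξ) rfl, ← (flow_completeLift_of_mem_tangentLift hS hU
    (mem_flowDomain_tangentLift_of_completeLift hS hU h)).2, kappa_kappa]

end CompleteLift

/-! ### The slashed bundles -/

section Slashed

variable (M : SmoothMfd.{u})

theorem contMDiff_projBase (r : ℕ) : ContMDiff (M.iter r).I M.I ∞ (M.projBase r) := by
  induction r with
  | zero => exact contMDiff_id
  | succ r ih => exact ih.comp contMDiff_π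

/-- The zero vectors form the coincidence set of the identity and the zero section after $\pi$,
which is closed since $TN$ is Hausdorff. -/
theorem isOpen_fib_ne_zero (N : SmoothMfd.{u}) [T2Space N] : IsOpen {ξ : N.T | fib ξ ≠ 0} := by
  have hz : Continuous (zeroVec (N := N)) :=
    (Bundle.contMDiff_zeroSection ℝ (TangentSpace N.I : N → Type _) (IB := N.I) (n := ∞)
      (F := N.E)).continuous
  have h : {ξ : N.T | fib ξ ≠ 0} = {ξ | ξ = zeroVec (π ξ)}ᶜ := by
    ext ξ
    refine not_congr ⟨fun h => ?_, fun h => ?_⟩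
    · have h1 : ξ = vec (π ξ) (fib ξ) := rfl
      rw [h] at h1
      exact h1
    · rw [h]
      rfl
  rw [h]
  exact (isClosed_eq continuous_id (hz.comp continuous_π)).isOpen_compl

theorem isOpen_slashed_succ [T2Space M] (r : ℕ) : IsOpen (M.slashed (r + 1)) := by
  have h1 : ContMDiffOn (M.iter r).T.I M.T.I ∞ (D (M.projBase r)) (π ⁻¹' univ) :=
    contMDiffOn_D (contMDiff_projBase M r).contMDiffOn isOpen_univ
  have h2 : Continuous (D (M.projBase r)) := continuousOn_univ.1 h1.continuousOn
  exact (isOpen_fib_ne_zero M).preimage h2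

/-- The projection to $M$ factors through $\pi$, so the chain rule and $D\pi=\pi\circ\kappa$ reduce
the condition at $\xi$ to the one at $\pi\kappa\xi$. This identifies the slashed bundle with the
natural domain of $S^c$. -/
theorem slashed_add_two (r : ℕ) [(M.iter r).I.Boundaryless] :
    M.slashed (r + 2) = kappa (N := M.iter r) ⁻¹' (π ⁻¹' M.slashed (r + 1)) := by
  ext ξ
  have h : D (M.projBase (r + 1)) ξ = D (M.projBase r) (D (π (N := M.iter r)) ξ) :=
    D_comp (N := M.iter (r + 1)) ((contMDiff_projBase M r).contMDiffAt.mdifferentiableAt (by simp))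
      (mdifferentiableAt_π _)
  have h' := h.trans (congrArg (D (M.projBase r)) (D_π_eq (N := M.iter r) ξ))
  change fib (D (M.projBase (r + 1)) ξ) ≠ 0 ↔ fib (D (M.projBase r) (π (kappa ξ))) ≠ 0
  rw [h']

instance instBoundarylessIter [M.I.Boundaryless] (r : ℕ) : (M.iter r).I.Boundaryless := by
  induction r with
  | zero => assumption
  | succ r ih => exact instBoundarylessT

instance instCompleteSpaceIter [CompleteSpace M.E] (r : ℕ) : CompleteSpace (M.iter r).E := by
  induction r with
  | zero => assumption
  | succ r ih => exact instCompleteSpaceT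

instance instT2SpaceIter [T2Space M] (r : ℕ) : T2Space (M.iter r) := by
  induction r with
  | zero => assumption
  | succ r ih => exact instT2SpaceT

end Slashed

end SmoothMfd

end

theorem mainTheorem7 (n : ℕ) (M : Type u) [TopologicalSpace M]
    [ChartedSpace (EuclideanSpace ℝ (Fin n)) M] [IsManifold (𝓡 n) ∞ M]
    [T2Space M] [SecondCountableTopology M] (r : ℕ)
    (S : ((SmoothMfd.ofManifold n M).iter r).T → ((SmoothMfd.ofManifold n M).iter r).T.T)
    (hS : (SmoothMfd.ofManifold n M).IsSpray r S) :
    (fun p : ((SmoothMfd.ofManifold n M).iter r).T.T × ℝ =>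
        (SmoothMfd.D (SmoothMfd.π (N := (SmoothMfd.ofManifold n M).iter r)) p.1, p.2)) ''
        SmoothMfd.flowDomain (SmoothMfd.completeLift S)
          ((SmoothMfd.ofManifold n M).slashed (r + 2)) =
      SmoothMfd.flowDomain S ((SmoothMfd.ofManifold n M).slashed (r + 1)) ∧
    ∀ (ξ : ((SmoothMfd.ofManifold n M).iter r).T.T) (t : ℝ),
      (ξ, t) ∈ SmoothMfd.flowDomain (SmoothMfd.completeLift S)
          ((SmoothMfd.ofManifold n M).slashed (r + 2)) →
        MDifferentiableAt ((SmoothMfd.ofManifold n M).iter r).T.I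
            ((SmoothMfd.ofManifold n M).iter r).T.I
            (SmoothMfd.flow S ((SmoothMfd.ofManifold n M).slashed (r + 1)) t)
            (SmoothMfd.π (SmoothMfd.kappa ξ)) ∧
          SmoothMfd.flow (SmoothMfd.completeLift S)
              ((SmoothMfd.ofManifold n M).slashed (r + 2)) t ξ =
            SmoothMfd.kappa (SmoothMfd.D
              (SmoothMfd.flow S ((SmoothMfd.ofManifold n M).slashed (r + 1)) t)
              (SmoothMfd.kappa ξ)) := by
  have : (SmoothMfd.ofManifold n M).I.Boundaryless := inferInstanceAs (𝓡 n).Boundaryless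
  have : T2Space (SmoothMfd.ofManifold n M) := inferInstanceAs (T2Space M)
  have : CompleteSpace (SmoothMfd.ofManifold n M).E :=
    inferInstanceAs (CompleteSpace (EuclideanSpace ℝ (Fin n)))
  have hU := (SmoothMfd.ofManifold n M).isOpen_slashed_succ r
  have hX := hS.isVectorFieldOn
  rw [SmoothMfd.slashed_add_two]
  refine ⟨?_, fun ξ t h => SmoothMfd.flow_completeLift hX hU h⟩
  ext ⟨y, t⟩
  constructor
  · rintro ⟨⟨ξ, s⟩, h, heq⟩
    rw [← heq]
    change (SmoothMfd.D (SmoothMfd.π (N := (SmoothMfd.ofManifold n M).iter r)) ξ, s) ∈ _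
    rw [SmoothMfd.D_π_eq]
    exact (SmoothMfd.mem_flowDomain_completeLift_iff hX hU).1 h
  · intro h
    -- Any vector $\eta$ over $y$ would do, as $D\pi(\kappa\eta)=\pi\eta=y$; the zero vector is a
    -- canonical choice.
    refine ⟨(SmoothMfd.kappa (SmoothMfd.zeroVec y), t),
      (SmoothMfd.mem_flowDomain_completeLift_iff hX hU).2 ?_, ?_⟩
    · rwa [SmoothMfd.kappa_kappa]
    · exact Prod.ext (SmoothMfd.D_π_eq _) rfl
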